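/- Let $\ell,m\ge 1$, let $\Sigma=\{a_1,\dots,a_\ell,b\}$, let $\xi,\eta\in[0,\infty)^m$, and let $A_1,\dots,A_\ell,B\in[0,\infty)^{m\times m}$ be non-zero matrices. Let $\mu:\Sigma^*\to[0,\infty)^{m\times m}$ be the monoid morphism with $\mu(a_i)=A_i$ and $\mu(b)=B$, and put $(r,w)=\xi'\mu(w)\eta$ for $w\in\Sigma^*$. Assume that for every sufficiently large $n$ some word $w\in\Sigma^n$ has $(r,w)>0$. For each $n$ for which such a word exists, let $w\in\Sigma^n$ be random with probability $\Pr(w)=(r,w)/\sum_{x\in\Sigma^n}(r,x)$, and let $\mathbf Y_n=(|w|_{a_1},\dots,|w|_{a_\ell})$, where $|w|_{a_i}$ is the number of occurrences of $a_i$ in $w$. Assume that $M=A_1+\cdots+A_\ell+B$ is primitive (some positive power of $M$ has only strictly positive entries), and let $\lambda$ be its Perron–Frobenius eigenvalue. For $\mathbf t\in\mathbb R^\ell$ let $M(\mathbf t)=A_1e^{t_1}+\cdots+A_\ell e^{t_\ell}+B$ and let $y(\mathbf t)$ be the largest modulus of the complex eigenvalues of $M(\mathbf t)$. Then: 1. For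 every $\mathbf t$, $y(\mathbf t)$ is the Perron–Frobenius eigenvalue of $M(\mathbf t)$: $y(\mathbf t)>0$, $\det(y(\mathbf t)I-M(\mathbf t))=0$, and every other complex eigenvalue of $M(\mathbf t)$ has modulus strictly smaller than $y(\mathbf t)$. The function $y$ is real analytic on $\mathbb R^\ell$ (and $y(\mathbf 0)=\lambda$). Hence $$\boldsymbol\beta=\frac{\nabla y(\mathbf 0)}{\lambda},\qquad \Gamma=H\log y(\mathbf 0)=\Big[\tfrac{\partial^2\log y}{\partial t_i\partial t_j}(\mathbf 0)\Big]_{i,j}$$ are well defined. The matrix $\Gamma$ is symmetric and positive semidefinite. 2. For every $\mathbf t\in\mathbb R^\ell$, the moment generating functions satisfy $$\lim_{n\to\infty}\mathbb E\Big[\exp\Big(\mathbf t'\,\frac{\mathbf Y_n-n\boldsymbol\beta}{\sqrt n}\Big)\Big]=\exp\big(\tfrac12\mathbf t'\Gamma\mathbf t\big).$$ 3. As $n\to\infty$, $\dfrac{\mathbf Y_n-n\boldsymbol\beta}{\sqrt n}$ converges in distribution to the centered (possibly degenerate) multivariate Gaussian $N(\mathbf 0,\Gamma)$ with covariance matrix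 $\Gamma$. -/

import Mathlib

open MeasureTheory ProbabilityTheory Filter Topology Matrix

namespace RationalModel

/-- The alphabet `{a_1, …, a_ℓ, b}`: `some i` is the letter `a_i` and `none` is the letter `b`. -/
abbrev Letter (ℓ : ℕ) : Type := Option (Fin ℓ)

/-- The set of words of length `n`, with the discrete σ-algebra. -/
def Word (ℓ n : ℕ) : Type := Fin n → Letter ℓ

instance (ℓ n : ℕ) : Fintype (Word ℓ n) := inferInstanceAs (Fintype (Fin n → Letter ℓ))

instance (ℓ n : ℕ) : MeasurableSpace (Word ℓ n) := ⊤

/-- A word of length `n` as an element of the free monoid over the alphabet. -/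
def Word.toFree {ℓ n : ℕ} (w : Word ℓ n) : FreeMonoid (Letter ℓ) :=
  FreeMonoid.ofList (List.ofFn w)

/-- `Y_n(w) = (|w|_{a_1}, …, |w|_{a_ℓ})`, as a vector of the Euclidean space. -/
noncomputable def Word.Y {ℓ n : ℕ} (w : Word ℓ n) : EuclideanSpace ℝ (Fin ℓ) :=
  WithLp.toLp 2 fun i => ((List.ofFn w).count (some i) : ℝ)

/-- A linear representation `(ξ, μ, η)` with nonnegative entries: the initial and final weights
`ξ`, `η`, and the nonzero matrices `A_i = μ(a_i)` and `B = μ(b)`. -/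
structure LinearRepresentation (ℓ m : ℕ) where
  ξ : Fin m → ℝ
  η : Fin m → ℝ
  A : Fin ℓ → Matrix (Fin m) (Fin m) ℝ
  B : Matrix (Fin m) (Fin m) ℝ
  ξ_nonneg : ∀ p, 0 ≤ ξ p
  η_nonneg : ∀ p, 0 ≤ η p
  A_nonneg : ∀ i p q, 0 ≤ A i p q
  B_nonneg : ∀ p q, 0 ≤ B p q
  A_ne_zero : ∀ i, A i ≠ 0
  B_ne_zero : B ≠ 0

/-- The Perron–Frobenius eigenvalue of a (primitive) real matrix: the largest modulus of its
complex eigenvalues. -/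
noncomputable def perronValue {m : ℕ} (T : Matrix (Fin m) (Fin m) ℝ) : ℝ :=
  (spectralRadius ℂ (T.map Complex.ofReal)).toReal

/-- `c` is a positive eigenvalue of `T` whose modulus strictly exceeds that of every other complex
eigenvalue of `T`. -/
def IsPerronEigenvalue {m : ℕ} (T : Matrix (Fin m) (Fin m) ℝ) (c : ℝ) : Prop :=
  0 < c ∧ (c • (1 : Matrix (Fin m) (Fin m) ℝ) - T).det = 0 ∧
    ∀ z : ℂ, (z • (1 : Matrix (Fin m) (Fin m) ℂ) - T.map Complex.ofReal).det = 0 →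
      z ≠ (c : ℂ) → ‖z‖ < c

/-- The partial derivative `∂f/∂t_i` at `t`. -/
noncomputable def pderiv {ℓ : ℕ} (i : Fin ℓ) (f : EuclideanSpace ℝ (Fin ℓ) → ℝ)
    (t : EuclideanSpace ℝ (Fin ℓ)) : ℝ :=
  lineDeriv ℝ f t (EuclideanSpace.single i 1)

/-- The Hessian matrix `[∂²f/∂t_i∂t_j]` at `t`. -/
noncomputable def hessian {ℓ : ℕ} (f : EuclideanSpace ℝ (Fin ℓ) → ℝ)
    (t : EuclideanSpace ℝ (Fin ℓ)) : Matrix (Fin ℓ) (Fin ℓ) ℝ :=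
  Matrix.of fun i j => pderiv i (pderiv j f) t

namespace LinearRepresentation

variable {ℓ m : ℕ} (R : LinearRepresentation ℓ m)

/-- The matrix of a letter. -/
def letterMatrix : Letter ℓ → Matrix (Fin m) (Fin m) ℝ
  | some i => R.A i
  | none => R.B

/-- The monoid morphism `μ` with `μ(a_i) = A_i` and `μ(b) = B`. -/
def mu : FreeMonoid (Letter ℓ) →* Matrix (Fin m) (Fin m) ℝ :=
  FreeMonoid.lift R.letterMatrix

/-- The rational series `(r, w) = ξ' μ(w) η`. -/
def coeff (w : FreeMonoid (Letter ℓ)) : ℝ := R.ξ ⬝ᵥ (R.mu w *ᵥ R.η)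

/-- The lengths `n` for which some word of length `n` has positive weight, i.e. for which the
probability measure on words of length `n` is defined. -/
def lengths : Set ℕ := {n | ∃ w : Word ℓ n, 0 < R.coeff w.toFree}

theorem mu_nonneg (w : FreeMonoid (Letter ℓ)) : ∀ p q, 0 ≤ R.mu w p q := by
  induction w using FreeMonoid.inductionOn' with
  | one =>
    intro p q
    rw [map_one, Matrix.one_apply]
    split_ifs <;> norm_num
  | of_mul a w ih =>
    intro p q
    rw [map_mul, Matrix.mul_apply]
    refine Finset.sum_nonneg fun k _ => mul_nonneg ?_ (ih k q)
    rw [mu, FreeMonoid.lift_eval_of]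
    cases a with
    | none => exact R.B_nonneg p k
    | some i => exact R.A_nonneg i p k

theorem coeff_nonneg (w : FreeMonoid (Letter ℓ)) : 0 ≤ R.coeff w :=
  dotProduct_nonneg_of_nonneg (fun p => R.ξ_nonneg p) fun p =>
    dotProduct_nonneg_of_nonneg (fun q => R.mu_nonneg w p q) fun q => R.η_nonneg q

theorem sum_coeff_pos {n : ℕ} (hn : n ∈ R.lengths) : 0 < ∑ x : Word ℓ n, R.coeff x.toFree := by
  obtain ⟨w, hw⟩ := hn
  exact Finset.sum_pos' (fun x _ => R.coeff_nonneg _) ⟨w, Finset.mem_univ _, hw⟩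

/-- The probability function `Pr(w) = (r, w) / ∑_{|x| = n} (r, x)` on the words of length `n`. -/
noncomputable def wordPMF (n : R.lengths) : PMF (Word ℓ n) :=
  PMF.ofFintype
    (fun w => ENNReal.ofReal (R.coeff w.toFree / ∑ x : Word ℓ n, R.coeff x.toFree)) <| by
      have h := R.sum_coeff_pos n.2
      rw [← ENNReal.ofReal_sum_of_nonneg fun w _ => div_nonneg (R.coeff_nonneg _) h.le,
        ← Finset.sum_div, div_self h.ne', ENNReal.ofReal_one]

/-- The probability measure on the words of length `n`. -/
noncomputable def wordMeasure (n : R.lengths) : Measure (Word ℓ n) := (R.wordPMF n).toMeasure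

instance (n : R.lengths) : IsProbabilityMeasure (R.wordMeasure n) :=
  inferInstanceAs (IsProbabilityMeasure (R.wordPMF n).toMeasure)

/-- `M = A_1 + ⋯ + A_ℓ + B`. -/
def M : Matrix (Fin m) (Fin m) ℝ := ∑ i, R.A i + R.B

/-- `M(t) = A_1 e^{t_1} + ⋯ + A_ℓ e^{t_ℓ} + B`. -/
noncomputable def Mt (t : EuclideanSpace ℝ (Fin ℓ)) : Matrix (Fin m) (Fin m) ℝ :=
  ∑ i, Real.exp (t i) • R.A i + R.B

/-- The Perron–Frobenius eigenvalue of `M(t)`. -/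
noncomputable def y (t : EuclideanSpace ℝ (Fin ℓ)) : ℝ := perronValue (R.Mt t)

theorem y_zero : R.y 0 = perronValue R.M := by
  simp [y, Mt, M]

/-- `β = ∇y(0) / λ`, where `λ` is the Perron–Frobenius eigenvalue of `M`. -/
noncomputable def β : EuclideanSpace ℝ (Fin ℓ) :=
  WithLp.toLp 2 fun i => pderiv i R.y 0 / perronValue R.M

/-- `Γ = H log y(0)`. -/
noncomputable def Γ : Matrix (Fin ℓ) (Fin ℓ) ℝ := hessian (fun t => Real.log (R.y t)) 0

/-- The random variable `(Y_n - nβ) / √n` on the words of length `n`. -/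
noncomputable def normalizedY (n : R.lengths) (w : Word ℓ n) : EuclideanSpace ℝ (Fin ℓ) :=
  (Real.sqrt (n : ℕ))⁻¹ • (w.Y - ((n : ℕ) : ℝ) • R.β)

end LinearRepresentation

end RationalModel

/-! Since `μ` is multiplicative, the sum of e^{s·Y(w)} (r,w) over words of length n is ξ' M(s)^n η.
The moment generating function of the normalized counts is therefore e^{-√n t·β} times the quotient
of ξ' M(t/√n)^n η by ξ' M(0)^n η. The core is `exists_tendsto_dotProduct_div_pow`: ξ' M(s_n)^n η ~ C
y(s_n)^n for every s_n → 0, with the same C for all such sequences. So C cancels, and there remains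
the exponential of n(log y(t/√n) - log y(0)) - √n t·β, which tends to exp(t'Γt/2) by Taylor
expansion.

For the core, conjugation by the Perron vector and division by y(s) turn M(s) into a row-stochastic
matrix depending continuously on s near 0. By Doeblin contraction a fixed power already makes every
function nearly constant, and later powers only average, so perturbing the matrix does no harm.

The Perron theory comes from the same contraction together with Gelfand's formula. Analyticity of y
comes from the implicit function theorem for the eigenpair equations, nondegenerate because the
Perron eigenvalue is simple. Finally, convergent moment generating functions force tightness, and
every limit point has that of N(0,Γ), hence equals it. -/

namespace RationalModel

/-! ### Row-stochastic matrices and Doeblin contraction. -/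

section Stochastic

variable {ι : Type*} [Fintype ι]

theorem exists_pos_le_of_forall_pos [Nonempty ι] {P : Matrix ι ι ℝ} (hP : ∀ i j, 0 < P i j) :
    ∃ δ > 0, ∀ i j, δ ≤ P i j := by
  obtain ⟨x, -, hx⟩ := Finset.exists_min_image (Finset.univ : Finset (ι × ι))
    (fun x => P x.1 x.2) Finset.univ_nonempty
  exact ⟨P x.1 x.2, hP _ _, fun i j => hx (i, j) (Finset.mem_univ _)⟩

variable [DecidableEq ι]

/-- The Doeblin contraction: a row-stochastic matrix whose entries are at least `δ` shrinks the
diameter of the range of a function by the factor `1 - δ`. -/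
theorem norm_sum_smul_sub_sum_smul_le {E : Type*} [NormedAddCommGroup E] [NormedSpace ℝ E]
    {P : Matrix ι ι ℝ} (hP : P ∈ rowStochastic ℝ ι) {δ : ℝ} (hδ : ∀ i j, δ ≤ P i j)
    {f : ι → E} {D : ℝ} (hD : ∀ k l, ‖f k - f l‖ ≤ D) (i j : ι) :
    ‖∑ k, P i k • f k - ∑ l, P j l • f l‖ ≤ (1 - δ) * D := by
  have hs := sum_row_of_mem_rowStochastic hP
  have hn : ∀ i j, 0 ≤ P i j := hP.1
  have hD0 : 0 ≤ D := (norm_nonneg _).trans (hD i i)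
  have e1 : ∑ k, P i k • f k - ∑ l, P j l • f l
      = ∑ k, ∑ l, (P i k * P j l) • (f k - f l) := by
    simp only [smul_sub, Finset.sum_sub_distrib]
    congr 1
    · refine Finset.sum_congr rfl fun k _ => ?_
      rw [← Finset.sum_smul, ← Finset.mul_sum, hs, mul_one]
    · rw [Finset.sum_comm]
      refine Finset.sum_congr rfl fun l _ => ?_
      rw [← Finset.sum_smul, ← Finset.sum_mul, hs, one_mul]
  rw [e1]
  -- In this independent coupling of rows i and j the diagonal terms vanish. Their total mass ∑ P i
  -- k * P j k is at least δ, which is the gain over the trivial bound D.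
  have e2 : ∀ k l, ‖(P i k * P j l) • (f k - f l)‖
      ≤ P i k * P j l * D - if k = l then P i k * P j l * D else 0 := by
    intro k l
    split_ifs with h
    · simp [h]
    · rw [norm_smul, Real.norm_of_nonneg (mul_nonneg (hn _ _) (hn _ _)), sub_zero]
      exact mul_le_mul_of_nonneg_left (hD k l) (mul_nonneg (hn _ _) (hn _ _))
  calc _ ≤ ∑ k, ∑ l, (P i k * P j l * D - if k = l then P i k * P j l * D else 0) :=
        (norm_sum_le _ _).trans (Finset.sum_le_sum fun k _ => (norm_sum_le _ _).trans
          (Finset.sum_le_sum fun l _ => e2 k l))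
    _ = D - ∑ k, P i k * P j k * D := by
        simp only [Finset.sum_sub_distrib, Finset.sum_ite_eq, Finset.mem_univ, if_true]
        congr 1
        simp only [← Finset.sum_mul, ← Finset.mul_sum, hs, mul_one, one_mul]
    _ ≤ D - ∑ k, P i k * δ * D := by
        gcongr with k
        · exact hn _ _
        · exact hδ _ _
    _ = (1 - δ) * D := by rw [← Finset.sum_mul, ← Finset.sum_mul, hs]; ring

theorem pow_map_ofReal (P : Matrix ι ι ℝ) (k : ℕ) :
    (P ^ k).map Complex.ofReal = (P.map Complex.ofReal) ^ k :=
  map_pow (Complex.ofRealHom.mapMatrix (m := ι)) P k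

theorem pow_mulVec_eq_smul {R : Type*} [CommRing R] {T : Matrix ι ι R} {w : ι → R} {z : R}
    (h : T *ᵥ w = z • w) (k : ℕ) : (T ^ k) *ᵥ w = z ^ k • w := by
  induction k with
  | zero => simp
  | succ k ih => rw [pow_succ, ← mulVec_mulVec, h, mulVec_smul, ih, smul_smul, pow_succ']

/-- `P ^ k` multiplies the diameter of the range of g by |ζ|^k ≥ 1, yet contracts it by 1 - δ < 1;
the diameter is zero. -/
theorem eq_of_rowStochastic_eigenvector [Nonempty ι] {P : Matrix ι ι ℝ}
    (hP : P ∈ rowStochastic ℝ ι) {k : ℕ} (hk : ∀ i j, 0 < (P ^ k) i j) {g : ι → ℂ} {ζ : ℂ}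
    (hg : (P.map Complex.ofReal) *ᵥ g = ζ • g) (hζ : 1 ≤ ‖ζ‖) (i j : ι) : g i = g j := by
  obtain ⟨δ, hδ, hδP⟩ := exists_pos_le_of_forall_pos hk
  obtain ⟨x, -, hx⟩ := Finset.exists_max_image (Finset.univ : Finset (ι × ι))
    (fun x => ‖g x.1 - g x.2‖) Finset.univ_nonempty
  have h1 := norm_sum_smul_sub_sum_smul_le (pow_mem hP k) hδP (f := g)
    (fun k l => hx (k, l) (Finset.mem_univ _)) x.1 x.2
  have h2 : ∀ i, ∑ l, (P ^ k) i l • g l = ζ ^ k * g i := by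
    intro i
    have := congrFun (pow_mulVec_eq_smul hg k) i
    rw [← pow_map_ofReal] at this
    simpa [mulVec, dotProduct] using this
  rw [h2, h2, ← mul_sub, norm_mul, norm_pow] at h1
  have h3 : 1 ≤ ‖ζ‖ ^ k := one_le_pow₀ hζ
  have h4 : ‖g x.1 - g x.2‖ ≤ 0 := by nlinarith [norm_nonneg (g x.1 - g x.2)]
  exact sub_eq_zero.1 (norm_le_zero_iff.1 ((hx (i, j) (Finset.mem_univ _)).trans h4))

theorem mulVec_mem_Icc_of_rowStochastic {P : Matrix ι ι ℝ} (hP : P ∈ rowStochastic ℝ ι)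
    {f : ι → ℝ} {a b : ℝ} (hf : ∀ i, f i ∈ Set.Icc a b) (i : ι) : (P *ᵥ f) i ∈ Set.Icc a b := by
  have hs := sum_row_of_mem_rowStochastic hP i
  constructor
  · calc a = ∑ j, P i j * a := by rw [← Finset.sum_mul, hs, one_mul]
      _ ≤ _ := Finset.sum_le_sum fun j _ => mul_le_mul_of_nonneg_left (hf j).1 (hP.1 i j)
  · calc _ ≤ ∑ j, P i j * b :=
          Finset.sum_le_sum fun j _ => mul_le_mul_of_nonneg_left (hf j).2 (hP.1 i j)
      _ = b := by rw [← Finset.sum_mul, hs, one_mul]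

theorem exists_abs_pow_mulVec_sub_le {P : Matrix ι ι ℝ} [Nonempty ι]
    (hP : P ∈ rowStochastic ℝ ι) {k : ℕ} (hk : ∀ i j, 0 < (P ^ k) i j) (f : ι → ℝ) {ε : ℝ}
    (hε : 0 < ε) : ∃ N, ∀ i j, |((P ^ N) *ᵥ f) i - ((P ^ N) *ᵥ f) j| ≤ ε := by
  obtain ⟨δ, hδ, hδP⟩ := exists_pos_le_of_forall_pos hk
  obtain ⟨x, -, hx⟩ := Finset.exists_max_image (Finset.univ : Finset (ι × ι))
    (fun x => |f x.1 - f x.2|) Finset.univ_nonempty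
  set D := |f x.1 - f x.2|
  have hδ1 : δ ≤ 1 :=
    (hδP x.1 x.1).trans (le_one_of_mem_rowStochastic (pow_mem hP k))
  have key : ∀ n : ℕ, ∀ i j, |((P ^ (k * n)) *ᵥ f) i - ((P ^ (k * n)) *ᵥ f) j|
      ≤ (1 - δ) ^ n * D := by
    intro n
    induction n with
    | zero => intro i j; simpa using hx (i, j) (Finset.mem_univ _)
    | succ n ih =>
      intro i j
      rw [mul_add, mul_one, add_comm, pow_add, ← mulVec_mulVec, pow_succ', mul_assoc]
      simpa [mulVec, dotProduct] using
        norm_sum_smul_sub_sum_smul_le (pow_mem hP k) hδP (f := (P ^ (k * n)) *ᵥ f) ih i j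
  have hlim : Tendsto (fun n : ℕ => (1 - δ) ^ n * D) atTop (𝓝 0) := by
    simpa using (tendsto_pow_atTop_nhds_zero_of_lt_one (by linarith) (by linarith)).mul_const D
  obtain ⟨n, hn⟩ := (hlim.eventually (ge_mem_nhds hε)).exists
  exact ⟨k * n, fun i j => (key n i j).trans hn⟩

/-- Once the oscillation is at most ε at time K, further stochastic powers are averages and stay in
the same window. -/
theorem exists_forall_abs_pow_mulVec_sub_le [Nonempty ι] {P : Matrix ι ι ℝ}
    (hP : P ∈ rowStochastic ℝ ι) {k : ℕ} (hk : ∀ i j, 0 < (P ^ k) i j) (f : ι → ℝ) (i₀ : ι) {ε : ℝ}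
    (hε : 0 < ε) : ∃ K, ∀ n ≥ K, ∀ i, |((P ^ n) *ᵥ f) i - ((P ^ K) *ᵥ f) i₀| ≤ ε := by
  obtain ⟨K, hK⟩ := exists_abs_pow_mulVec_sub_le hP hk f hε
  refine ⟨K, fun n hn i => ?_⟩
  have h := mulVec_mem_Icc_of_rowStochastic (pow_mem hP (n - K)) (f := (P ^ K) *ᵥ f)
    (a := ((P ^ K) *ᵥ f) i₀ - ε) (b := ((P ^ K) *ᵥ f) i₀ + ε)
    (fun j => by have := abs_le.1 (hK j i₀); constructor <;> linarith) i
  rw [mulVec_mulVec, ← pow_add, Nat.sub_add_cancel hn] at h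
  rw [abs_le]; constructor <;> linarith [h.1, h.2]

theorem exists_tendsto_pow_mulVec_apply [Nonempty ι] {P : Matrix ι ι ℝ}
    (hP : P ∈ rowStochastic ℝ ι) {k : ℕ} (hk : ∀ i j, 0 < (P ^ k) i j) (f : ι → ℝ) (i₀ : ι) :
    ∃ c, Tendsto (fun n => ((P ^ n) *ᵥ f) i₀) atTop (𝓝 c) := by
  refine cauchySeq_tendsto_of_complete (Metric.cauchySeq_iff'.2 fun ε hε => ?_)
  obtain ⟨K, hK⟩ := exists_forall_abs_pow_mulVec_sub_le hP hk f i₀ (half_pos hε)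
  refine ⟨K, fun n hn => ?_⟩
  rw [Real.dist_eq]
  exact (hK n hn i₀).trans_lt (half_lt_self hε)

/-- Powers of a primitive row-stochastic matrix converge to a rank-one projection, and the limit is
stable under perturbation of the matrix along the sequence of powers. -/
theorem exists_tendsto_pow_mulVec [Nonempty ι] {P : Matrix ι ι ℝ}
    (hP : P ∈ rowStochastic ℝ ι) {k : ℕ} (hk : ∀ i j, 0 < (P ^ k) i j) {f : ι → ℝ}
    (hf : ∀ i, 0 ≤ f i) (hf0 : ∃ i, 0 < f i) :
    ∃ c > 0, ∀ {α : Type} {l : Filter α} {Q : α → Matrix ι ι ℝ} {g : α → ι → ℝ} {N : α → ℕ},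
      (∀ᶠ a in l, Q a ∈ rowStochastic ℝ ι) → Tendsto Q l (𝓝 P) → Tendsto g l (𝓝 f) →
      Tendsto N l atTop → ∀ i, Tendsto (fun a => ((Q a ^ N a) *ᵥ g a) i) l (𝓝 c) := by
  obtain ⟨i₀⟩ := ‹Nonempty ι›
  have osc := fun ε => exists_forall_abs_pow_mulVec_sub_le hP hk f i₀ (ε := ε)
  obtain ⟨c, hc⟩ := exists_tendsto_pow_mulVec_apply hP hk f i₀
  refine ⟨c, ?_, ?_⟩
  -- The lower bound δ * f j is reached at time k and preserved by averaging, so it passes to the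
  -- limit c.
  · obtain ⟨δ, hδ, hδP⟩ := exists_pos_le_of_forall_pos hk
    obtain ⟨j, hj⟩ := hf0
    have h1 : ∀ i, δ * f j ≤ ((P ^ k) *ᵥ f) i := fun i =>
      (mul_le_mul_of_nonneg_right (hδP i j) hj.le).trans
        (Finset.single_le_sum (f := fun j => (P ^ k) i j * f j)
          (fun l _ => mul_nonneg (hk i l).le (hf l)) (Finset.mem_univ j))
    have h2 : ∀ n ≥ k, δ * f j ≤ ((P ^ n) *ᵥ f) i₀ := by
      intro n hn
      obtain ⟨b, hb⟩ := (Set.finite_range ((P ^ k) *ᵥ f)).bddAbove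
      have := (mulVec_mem_Icc_of_rowStochastic (pow_mem hP (n - k)) (f := (P ^ k) *ᵥ f)
        (fun i => ⟨h1 i, hb ⟨i, rfl⟩⟩) i₀).1
      rwa [mulVec_mulVec, ← pow_add, Nat.sub_add_cancel hn] at this
    exact (mul_pos hδ hj).trans_le (ge_of_tendsto hc (eventually_atTop.2 ⟨k, h2⟩))
  · intro α l Q g N hQ hQP hg hN i
    rw [Metric.tendsto_nhds]
    intro ε hε
    obtain ⟨K, hK⟩ := osc (ε / 4) (by positivity)
    set z := ((P ^ K) *ᵥ f) i₀
    have hcz : |c - z| ≤ ε / 4 :=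
      le_of_tendsto ((hc.sub_const z).abs) (eventually_atTop.2 ⟨K, fun n hn => hK n hn i₀⟩)
    have hlim : Tendsto (fun a => (Q a ^ K) *ᵥ g a) l (𝓝 ((P ^ K) *ᵥ f)) := by
      have hcont : Continuous fun x : Matrix ι ι ℝ × (ι → ℝ) => x.1 *ᵥ x.2 := by fun_prop
      have := (hcont.tendsto (P ^ K, f)).comp ((hQP.pow K).prodMk_nhds hg)
      simpa only [Function.comp_def] using this
    have hev : ∀ᶠ a in l, ∀ j, |((Q a ^ K) *ᵥ g a) j - ((P ^ K) *ᵥ f) j| < ε / 4 := by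
      rw [eventually_all]
      intro j
      exact Metric.tendsto_nhds.1 (tendsto_pi_nhds.1 hlim j) (ε / 4) (by positivity)
    -- Continuity is needed only for the fixed power K, where all values lie within ε/4 + ε/4 of z.
    -- The other N a - K factors preserve this interval, and c is within ε/4 of z.
    filter_upwards [hQ, hev, hN.eventually_ge_atTop K] with a hQa ha hNa
    have h := mulVec_mem_Icc_of_rowStochastic (pow_mem hQa (N a - K)) (f := (Q a ^ K) *ᵥ g a)
      (a := z - ε / 2) (b := z + ε / 2)
      (fun j => by
        have h1 := abs_lt.1 (ha j)
        have h2 := abs_le.1 (hK K le_rfl j)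
        constructor <;> linarith) i
    rw [mulVec_mulVec, ← pow_add, Nat.sub_add_cancel hNa] at h
    have h3 := abs_le.1 hcz
    rw [Real.dist_eq, abs_lt]
    constructor <;> linarith [h.1, h.2]

end Stochastic

/-! ### Perron–Frobenius theory of primitive matrices. -/

section Perron

variable {m : ℕ} {T : Matrix (Fin m) (Fin m) ℝ} {v : Fin m → ℝ} {c : ℝ}

/-- The Doob transform `D⁻¹ T D / c` with `D = diag v`. -/
noncomputable def doob (T : Matrix (Fin m) (Fin m) ℝ) (v : Fin m → ℝ) (c : ℝ) :
    Matrix (Fin m) (Fin m) ℝ :=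
  Matrix.of fun i j => T i j * v j / (c * v i)

theorem doob_mem_rowStochastic (hT : ∀ i j, 0 ≤ T i j) (hv : ∀ i, 0 < v i) (hc : 0 < c)
    (h : T *ᵥ v = c • v) : doob T v c ∈ rowStochastic ℝ (Fin m) := by
  rw [mem_rowStochastic_iff_sum]
  refine ⟨fun i j => div_nonneg (mul_nonneg (hT i j) (hv j).le) (mul_pos hc (hv i)).le,
    fun i => ?_⟩
  simp only [doob, of_apply]
  rw [← Finset.sum_div, div_eq_one_iff_eq (mul_pos hc (hv i)).ne']
  exact congrFun h i

theorem doob_pow (hv : ∀ i, 0 < v i) (hc : 0 < c) (n : ℕ) (i j : Fin m) :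
    (doob T v c ^ n) i j = (T ^ n) i j * v j / (c ^ n * v i) := by
  induction n generalizing i j with
  | zero =>
    by_cases h : i = j
    · subst h; simp [(hv i).ne']
    · simp [h]
  | succ n ih =>
    rw [pow_succ, mul_apply, pow_succ, mul_apply, Finset.sum_mul, Finset.sum_div]
    refine Finset.sum_congr rfl fun l _ => ?_
    rw [ih]
    simp only [doob, of_apply]
    have := (hv i).ne'; have := (hv l).ne'
    field_simp
    ring

/-- `T ^ n` in terms of the powers of the Doob transform. -/
theorem pow_mulVec_eq_doob (hv : ∀ i, 0 < v i) (hc : 0 < c) (n : ℕ) (η : Fin m → ℝ)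
    (i : Fin m) :
    ((T ^ n) *ᵥ η) i = c ^ n * (v i * ((doob T v c ^ n) *ᵥ fun j => η j / v j) i) := by
  simp only [mulVec, dotProduct, Finset.mul_sum]
  refine Finset.sum_congr rfl fun j _ => ?_
  rw [doob_pow hv hc]
  have := (hv i).ne'; have := (hv j).ne'
  field_simp

theorem eigenvalue_pos_of_isPrimitive [NeZero m] (hT : T.IsPrimitive) (hv : ∀ i, 0 < v i)
    (h : T *ᵥ v = c • v) : 0 < c := by
  obtain ⟨k, hk, hTk⟩ := hT.exists_pos_pow
  have h0 : 0 ≤ c * v 0 := by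
    have := congrFun h 0
    simp only [Pi.smul_apply, smul_eq_mul] at this
    rw [← this]
    exact dotProduct_nonneg_of_nonneg (fun j => hT.nonneg 0 j) fun j => (hv j).le
  have hc0 : 0 ≤ c := nonneg_of_mul_nonneg_left h0 (hv 0)
  refine lt_of_le_of_ne hc0 fun hc => ?_
  have h1 := congrFun (pow_mulVec_eq_smul h k) 0
  rw [← hc, zero_pow hk.ne', zero_smul] at h1
  exact (Finset.sum_pos (fun j _ => mul_pos (hTk 0 j) (hv j)) Finset.univ_nonempty).ne' h1

theorem doob_pow_pos (hT : T.IsPrimitive) (hv : ∀ i, 0 < v i) (hc : 0 < c) :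
    ∃ k, ∀ i j, 0 < (doob T v c ^ k) i j := by
  obtain ⟨k, hk, hTk⟩ := hT.exists_pos_pow
  refine ⟨k, fun i j => ?_⟩
  rw [doob_pow hv hc]
  exact div_pos (mul_pos (hTk i j) (hv j)) (mul_pos (pow_pos hc k) (hv i))

/-- A complex eigenvalue of a primitive matrix either is the eigenvalue of the positive eigenvector,
with a proportional eigenvector, or has smaller modulus. -/
theorem eigenvector_dichotomy [NeZero m] (hT : T.IsPrimitive) (hv : ∀ i, 0 < v i)
    (h : T *ᵥ v = c • v) {z : ℂ} {w : Fin m → ℂ} (hw : w ≠ 0)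
    (hz : (T.map Complex.ofReal) *ᵥ w = z • w) :
    (z = c ∧ ∃ a : ℂ, ∀ i, w i = a * v i) ∨ ‖z‖ < c := by
  have hc := eigenvalue_pos_of_isPrimitive hT hv h
  rcases lt_or_ge ‖z‖ c with hlt | hge
  · exact Or.inr hlt
  left
  obtain ⟨k, hk⟩ := doob_pow_pos hT hv hc
  have hP := doob_mem_rowStochastic hT.nonneg hv hc h
  have hcC : (c : ℂ) ≠ 0 := by exact_mod_cast hc.ne'
  have hvC : ∀ i, (v i : ℂ) ≠ 0 := fun i => by exact_mod_cast (hv i).ne'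
  set g : Fin m → ℂ := fun i => w i / v i
  have hg : ((doob T v c).map Complex.ofReal) *ᵥ g = (z / c) • g := by
    ext i
    have h1 := congrFun hz i
    simp only [mulVec, dotProduct, map_apply, Pi.smul_apply, smul_eq_mul] at h1 ⊢
    have h2 : z / c * g i = (z * w i) / (c * v i) := by
      simp only [g]; field_simp
    rw [h2, ← h1, Finset.sum_div]
    refine Finset.sum_congr rfl fun j _ => ?_
    simp only [g, doob, of_apply]
    push_cast
    have := hvC i; have := hvC j
    field_simp
  have hconst := eq_of_rowStochastic_eigenvector hP hk hg
    (by rw [norm_div, Complex.norm_real, Real.norm_of_nonneg hc.le, one_le_div hc]; exact hge)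
  have hwg : ∀ i, w i = g 0 * v i := fun i => by
    rw [← hconst i 0]; simp only [g]; rw [div_mul_cancel₀ _ (hvC i)]
  refine ⟨?_, g 0, hwg⟩
  have hg0 : g 0 ≠ 0 := fun h0 => hw (by ext i; rw [hwg i, h0]; simp)
  have h1 := congrFun hz 0
  have h2 := congrFun h 0
  simp only [mulVec, dotProduct, map_apply, Pi.smul_apply, smul_eq_mul] at h1 h2
  have h3 : ∑ j, (T 0 j : ℂ) * w j = g 0 * (c * v 0) := by
    have : ((∑ j, T 0 j * v j : ℝ) : ℂ) = ((c * v 0 : ℝ) : ℂ) := by rw [h2]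
    push_cast at this
    rw [← this, Finset.mul_sum]
    exact Finset.sum_congr rfl fun j _ => by rw [hwg j]; ring
  rw [h3, hwg 0] at h1
  have h4 : (g 0 * v 0) * ((c : ℂ) - z) = 0 := by linear_combination h1
  rcases mul_eq_zero.1 h4 with h5 | h5
  · exact absurd h5 (mul_ne_zero hg0 (hvC 0))
  · exact (sub_eq_zero.1 h5).symm

theorem exists_eigenvector_of_det_eq_zero {R : Type*} [Field R] {A : Matrix (Fin m) (Fin m) R}
    {z : R} (h : (z • (1 : Matrix (Fin m) (Fin m) R) - A).det = 0) :
    ∃ w ≠ 0, A *ᵥ w = z • w := by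
  obtain ⟨w, hw, hw0⟩ := exists_mulVec_eq_zero_iff.2 h
  refine ⟨w, hw, ?_⟩
  rw [sub_mulVec, smul_mulVec, one_mulVec, sub_eq_zero] at hw0
  exact hw0.symm

theorem det_eq_zero_of_eigenvector {R : Type*} [Field R] {A : Matrix (Fin m) (Fin m) R}
    {z : R} {w : Fin m → R} (hw : w ≠ 0) (h : A *ᵥ w = z • w) :
    (z • (1 : Matrix (Fin m) (Fin m) R) - A).det = 0 :=
  exists_mulVec_eq_zero_iff.1 ⟨w, hw, by rw [sub_mulVec, smul_mulVec, one_mulVec, h, sub_self]⟩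

theorem mem_spectrum_iff_det {A : Matrix (Fin m) (Fin m) ℂ} {z : ℂ} :
    z ∈ spectrum ℂ A ↔ (z • (1 : Matrix (Fin m) (Fin m) ℂ) - A).det = 0 := by
  rw [spectrum.mem_iff, Algebra.algebraMap_eq_smul_one, Matrix.isUnit_iff_isUnit_det,
    isUnit_iff_ne_zero, not_not]

/-- The definition of `spectralRadius` uses no norm on matrices; the ℓ∞ operator norm is installed
locally only to have a Banach algebra, where the radius is attained. -/
theorem exists_mem_spectrum_norm_eq_perronValue [NeZero m] (T : Matrix (Fin m) (Fin m) ℝ) :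
    ∃ z ∈ spectrum ℂ (T.map Complex.ofReal), ‖z‖ = perronValue T := by
  let _ := Matrix.linftyOpNormedRing (n := Fin m) (α := ℂ)
  let _ := Matrix.linftyOpNormedAlgebra (n := Fin m) (α := ℂ) (R := ℂ)
  have : CompleteSpace (Matrix (Fin m) (Fin m) ℂ) := FiniteDimensional.complete ℂ _
  obtain ⟨z, hz, h⟩ := spectrum.exists_nnnorm_eq_spectralRadius (T.map Complex.ofReal)
  exact ⟨z, hz, by rw [perronValue, ← h]; simp⟩

/-- The Collatz–Wielandt lower bound: iterating the inequality gives r^n ≤ ‖T^n‖, and Gelfand's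
formula concludes. -/
theorem le_perronValue_of_smul_le_mulVec [NeZero m] (hT : ∀ i j, 0 ≤ T i j) {x : Fin m → ℝ}
    (hx : ∀ i, 0 < x i) {r : ℝ} (hr : 0 ≤ r) (h : ∀ i, r * x i ≤ (T *ᵥ x) i) :
    r ≤ perronValue T := by
  let _ := Matrix.linftyOpNormedRing (n := Fin m) (α := ℂ)
  let _ := Matrix.linftyOpNormedAlgebra (n := Fin m) (α := ℂ) (R := ℂ)
  have : CompleteSpace (Matrix (Fin m) (Fin m) ℂ) := FiniteDimensional.complete ℂ _
  obtain ⟨z, -, hz⟩ := spectrum.exists_nnnorm_eq_spectralRadius (T.map Complex.ofReal)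
  have hTn : ∀ n : ℕ, ∀ i j, 0 ≤ (T ^ n) i j := by
    intro n
    induction n with
    | zero => intro i j; rw [pow_zero, one_apply]; split_ifs <;> norm_num
    | succ n ih =>
      intro i j
      rw [pow_succ, mul_apply]
      exact Finset.sum_nonneg fun l _ => mul_nonneg (ih i l) (hT l j)
  have hpow : ∀ n : ℕ, ∀ i, r ^ n * x i ≤ ((T ^ n) *ᵥ x) i := by
    intro n
    induction n with
    | zero => simp
    | succ n ih =>
      intro i
      calc r ^ (n + 1) * x i = r * (r ^ n * x i) := by ring
        _ ≤ r * ((T ^ n) *ᵥ x) i := mul_le_mul_of_nonneg_left (ih i) hr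
        _ = ∑ j, (T ^ n) i j * (r * x j) := by
            simp only [mulVec, dotProduct, Finset.mul_sum]
            exact Finset.sum_congr rfl fun j _ => by ring
        _ ≤ ∑ j, (T ^ n) i j * (T *ᵥ x) j :=
            Finset.sum_le_sum fun j _ => mul_le_mul_of_nonneg_left (h j) (hTn n i j)
        _ = ((T ^ (n + 1)) *ᵥ x) i := by rw [pow_succ, ← mulVec_mulVec]; rfl
  obtain ⟨p, -, hp⟩ := Finset.exists_max_image Finset.univ x Finset.univ_nonempty
  -- At an index p maximizing x, row p of `T ^ n` has sum at least r^n, and the ℓ∞ operator norm is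
  -- the largest absolute row sum.
  have hnorm : ∀ n : ℕ, r ^ n ≤ ‖(T.map Complex.ofReal) ^ n‖ := by
    intro n
    have h1 : r ^ n * x p ≤ (∑ j, (T ^ n) p j) * x p := by
      refine (hpow n p).trans ?_
      rw [Finset.sum_mul]
      simp only [mulVec, dotProduct]
      exact Finset.sum_le_sum fun j _ =>
        mul_le_mul_of_nonneg_left (hp j (Finset.mem_univ _)) (hTn n p j)
    refine (le_of_mul_le_mul_right h1 (hx p)).trans ?_
    rw [← pow_map_ofReal, Matrix.linfty_opNorm_def]
    have h2 : ∑ j, (T ^ n) p j = ((∑ j, ‖((T ^ n).map Complex.ofReal) p j‖₊ : NNReal) : ℝ) := by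
      push_cast
      refine Finset.sum_congr rfl fun j _ => ?_
      simp [abs_of_nonneg (hTn n p j)]
    rw [h2]
    exact_mod_cast Finset.le_sup (f := fun i => ∑ j, ‖((T ^ n).map Complex.ofReal) i j‖₊)
      (Finset.mem_univ p)
  have hlim := spectrum.pow_norm_pow_one_div_tendsto_nhds_spectralRadius (T.map Complex.ofReal)
  have hle : ENNReal.ofReal r ≤ spectralRadius ℂ (T.map Complex.ofReal) := by
    refine ge_of_tendsto hlim (eventually_atTop.2 ⟨1, fun n hn => ENNReal.ofReal_le_ofReal ?_⟩)
    calc r = (r ^ n) ^ (1 / n : ℝ) := by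
          rw [one_div, Real.pow_rpow_inv_natCast hr (by omega)]
      _ ≤ _ := Real.rpow_le_rpow (pow_nonneg hr n) (hnorm n) (by positivity)
  rw [← hz] at hle
  rw [perronValue, ← hz]
  exact ENNReal.ofReal_le_iff_le_toReal (by simp) |>.1 hle

/-- **Perron's theorem**: a primitive matrix has a positive eigenvector for the eigenvalue of
largest modulus. -/
theorem exists_pos_eigenvector [NeZero m] (hT : T.IsPrimitive) :
    ∃ v : Fin m → ℝ, (∀ i, 0 < v i) ∧ T *ᵥ v = perronValue T • v := by
  obtain ⟨z, hz, hzn⟩ := exists_mem_spectrum_norm_eq_perronValue T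
  obtain ⟨w, hw, hwz⟩ := exists_eigenvector_of_det_eq_zero (mem_spectrum_iff_det.1 hz)
  obtain ⟨k, hk, hTk⟩ := hT.exists_pos_pow
  set ρ := perronValue T
  have hρ : 0 ≤ ρ := hzn ▸ norm_nonneg z
  set u : Fin m → ℝ := fun i => ‖w i‖
  have hu0 : ∀ i, 0 ≤ u i := fun i => norm_nonneg _
  have hule : ∀ i, ρ * u i ≤ (T *ᵥ u) i := by
    intro i
    have h1 := congrFun hwz i
    simp only [mulVec, dotProduct, map_apply, Pi.smul_apply, smul_eq_mul] at h1
    calc ρ * u i = ‖z * w i‖ := by rw [norm_mul, hzn]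
      _ ≤ ∑ j, ‖(T i j : ℂ) * w j‖ := by rw [← h1]; exact norm_sum_le _ _
      _ = (T *ᵥ u) i := by
        simp only [mulVec, dotProduct]
        refine Finset.sum_congr rfl fun j _ => ?_
        rw [norm_mul, Complex.norm_real, Real.norm_of_nonneg (hT.nonneg i j)]
  have hpos : ∀ x : Fin m → ℝ, (∀ i, 0 ≤ x i) → x ≠ 0 → ∀ i, 0 < ((T ^ k) *ᵥ x) i := by
    intro x hx hx0 i
    obtain ⟨j, hj⟩ := Function.ne_iff.1 hx0
    exact Finset.sum_pos' (fun l _ => mul_nonneg (hTk i l).le (hx l))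
      ⟨j, Finset.mem_univ j, mul_pos (hTk i j) (lt_of_le_of_ne (hx j) (Ne.symm hj))⟩
  have hune : u ≠ 0 := fun h => hw (by ext i; simpa [u] using congrFun h i)
  -- If T u ≥ ρ u were not an equality, applying the positive matrix `T ^ k` would make it strict in
  -- every coordinate. Then some r > ρ satisfies the Collatz–Wielandt inequality, contradicting the
  -- maximality of ρ.
  have heq : T *ᵥ u = ρ • u := by
    by_contra hne
    set x := (T ^ k) *ᵥ u
    have hx : ∀ i, 0 < x i := hpos u hu0 hune
    have hd : ∀ i, 0 < ((T ^ k) *ᵥ (T *ᵥ u - ρ • u)) i :=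
      hpos _ (fun i => by simpa using hule i) (sub_ne_zero.2 hne)
    have hd' : ∀ i, 0 < (T *ᵥ x) i - ρ * x i := by
      intro i
      have := hd i
      rw [mulVec_sub, mulVec_smul, mulVec_mulVec, ← pow_succ, pow_succ', ← mulVec_mulVec] at this
      exact this
    obtain ⟨p, -, hp⟩ := Finset.exists_min_image Finset.univ
      (fun i => ((T *ᵥ x) i - ρ * x i) / x i) Finset.univ_nonempty
    have hε := div_pos (hd' p) (hx p)
    have := le_perronValue_of_smul_le_mulVec hT.nonneg hx
      (r := ρ + ((T *ᵥ x) p - ρ * x p) / x p) (by positivity) (fun i => by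
        have h1 := hp i (Finset.mem_univ _)
        rw [le_div_iff₀ (hx i)] at h1
        linarith)
    linarith
  refine ⟨u, fun i => ?_, heq⟩
  have h1 := hpos u hu0 hune i
  rw [pow_mulVec_eq_smul heq] at h1
  exact pos_of_mul_pos_right h1 (pow_nonneg hρ k)

/-- This identifies the eigenvalue produced by the implicit function theorem with y(t): a positive
eigenvector is enough. -/
theorem perronValue_eq_of_pos_eigenvector [NeZero m] (hT : T.IsPrimitive) (hv : ∀ i, 0 < v i)
    (h : T *ᵥ v = c • v) : perronValue T = c := by
  have hc := eigenvalue_pos_of_isPrimitive hT hv h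
  obtain ⟨z, hz, hzn⟩ := exists_mem_spectrum_norm_eq_perronValue T
  obtain ⟨w, hw, hwz⟩ := exists_eigenvector_of_det_eq_zero (mem_spectrum_iff_det.1 hz)
  have hle : c ≤ perronValue T :=
    le_perronValue_of_smul_le_mulVec hT.nonneg hv hc.le fun i => by rw [h]; rfl
  rcases eigenvector_dichotomy hT hv h hw hwz with ⟨h1, -⟩ | h1
  · rw [← hzn, h1, Complex.norm_real, Real.norm_of_nonneg hc.le]
  · linarith

theorem isPerronEigenvalue_perronValue [NeZero m] (hT : T.IsPrimitive) :
    IsPerronEigenvalue T (perronValue T) := by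
  obtain ⟨v, hv, h⟩ := exists_pos_eigenvector hT
  refine ⟨eigenvalue_pos_of_isPrimitive hT hv h,
    det_eq_zero_of_eigenvector (fun h0 => (hv 0).ne' (congrFun h0 0)) h, fun z hz hne => ?_⟩
  obtain ⟨w, hw, hwz⟩ := exists_eigenvector_of_det_eq_zero hz
  exact (eigenvector_dichotomy hT hv h hw hwz).resolve_left fun h1 => hne h1.1

/-- If `T x - c x` is a multiple of the Perron vector `v`, then `x` is a multiple of `v` and the
multiple is zero: the Perron eigenvalue is algebraically simple. -/
theorem eq_smul_of_mulVec_sub_eq_smul [NeZero m] (hT : T.IsPrimitive) (hv : ∀ i, 0 < v i)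
    (h : T *ᵥ v = c • v) {x : Fin m → ℝ} {a : ℝ} (hx : T *ᵥ x - c • x = a • v) :
    a = 0 ∧ ∃ b : ℝ, x = b • v := by
  have hTv : ∀ i, (T *ᵥ v) i = c * v i := fun i => congrFun h i
  have hmono : ∀ y : Fin m → ℝ, (∀ i, 0 ≤ y i) → ∀ i, 0 ≤ (T *ᵥ y) i := fun y hy i =>
    dotProduct_nonneg_of_nonneg (fun j => hT.nonneg i j) hy
  -- Maximum principle for x/v: at a maximum T x - c x is nonpositive, at a minimum nonnegative,
  -- while a v has the sign of a everywhere.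
  have ha : a = 0 := by
    obtain ⟨p, -, hp⟩ := Finset.exists_max_image Finset.univ (fun i => x i / v i)
      Finset.univ_nonempty
    obtain ⟨q, -, hq⟩ := Finset.exists_min_image Finset.univ (fun i => x i / v i)
      Finset.univ_nonempty
    have h1 := hmono ((x p / v p) • v - x) (fun i => by
      have := hp i (Finset.mem_univ _)
      rw [div_le_iff₀ (hv i)] at this
      simpa using this) p
    have h2 := hmono (x - (x q / v q) • v) (fun i => by
      have := hq i (Finset.mem_univ _)
      rw [le_div_iff₀ (hv i)] at this
      simpa using this) q
    rw [mulVec_sub, mulVec_smul] at h1 h2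
    simp only [Pi.sub_apply, Pi.smul_apply, smul_eq_mul, hTv] at h1 h2
    have e1 := congrFun hx p
    have e2 := congrFun hx q
    simp only [Pi.sub_apply, Pi.smul_apply, smul_eq_mul] at e1 e2
    have f1 : x p / v p * (c * v p) = c * x p := by have := (hv p).ne'; field_simp
    have f2 : x q / v q * (c * v q) = c * x q := by have := (hv q).ne'; field_simp
    rw [f1] at h1
    rw [f2] at h2
    have g1 : a * v p ≤ 0 := by linarith
    have g2 : 0 ≤ a * v q := by linarith
    exact le_antisymm (nonpos_of_mul_nonpos_left g1 (hv p)) (nonneg_of_mul_nonneg_left g2 (hv q))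
  refine ⟨ha, ?_⟩
  by_cases hx0 : x = 0
  · exact ⟨0, by simp [hx0]⟩
  rw [ha, zero_smul, sub_eq_zero] at hx
  have hxC : (T.map Complex.ofReal) *ᵥ (fun i => (x i : ℂ)) = (c : ℂ) • fun i => (x i : ℂ) := by
    ext i
    have := congrFun hx i
    simp only [mulVec, dotProduct, map_apply, Pi.smul_apply, smul_eq_mul] at this ⊢
    exact_mod_cast this
  have hc := eigenvalue_pos_of_isPrimitive hT hv h
  rcases eigenvector_dichotomy hT hv h
    (fun h0 => hx0 (by ext i; simpa using congrFun h0 i)) hxC with ⟨-, b, hb⟩ | hlt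
  · refine ⟨b.re, funext fun i => ?_⟩
    have := congrArg Complex.re (hb i)
    simpa using this
  · rw [Complex.norm_real, Real.norm_of_nonneg hc.le] at hlt
    exact absurd hlt (lt_irrefl _)

end Perron

/-! ### Analyticity of y via the eigenpair equations. -/

namespace LinearRepresentation

open scoped ContDiff

variable {ℓ m : ℕ} (R : LinearRepresentation ℓ m)

theorem neZero (R : LinearRepresentation ℓ m) : NeZero m := by
  refine ⟨fun h => R.B_ne_zero ?_⟩
  subst h
  exact Subsingleton.elim _ _

theorem Mt_apply (t : EuclideanSpace ℝ (Fin ℓ)) (i j : Fin m) :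
    R.Mt t i j = ∑ k, Real.exp (t k) * R.A k i j + R.B i j := by
  simp [Mt, Matrix.add_apply, Matrix.sum_apply]

theorem M_apply (i j : Fin m) : R.M i j = ∑ k, R.A k i j + R.B i j := by
  simp [M, Matrix.add_apply, Matrix.sum_apply]

theorem isPrimitive_Mt (hM : R.M.IsPrimitive) (t : EuclideanSpace ℝ (Fin ℓ)) :
    (R.Mt t).IsPrimitive := by
  -- This constant lies below 1 and below every e^{t_k}, so M(t) ≥ c M entrywise, and positivity of
  -- a power of M is inherited.
  obtain ⟨c, hc, hct⟩ : ∃ c > 0, c ≤ 1 ∧ ∀ k, c ≤ Real.exp (t k) := by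
    refine ⟨Real.exp (-∑ k, |t k|), Real.exp_pos _, ?_, fun k => Real.exp_le_exp.2 ?_⟩
    · rw [Real.exp_le_one_iff, neg_nonpos]
      exact Finset.sum_nonneg fun k _ => abs_nonneg _
    · have := Finset.single_le_sum (f := fun k => |t k|) (fun k _ => abs_nonneg _)
        (Finset.mem_univ k)
      have := neg_abs_le (t k)
      simp only at *
      linarith
  have hle : ∀ i j, c * R.M i j ≤ R.Mt t i j := by
    intro i j
    rw [Mt_apply, M_apply, mul_add, Finset.mul_sum]
    refine add_le_add (Finset.sum_le_sum fun k _ => ?_) ?_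
    · exact mul_le_mul_of_nonneg_right (hct.2 k) (R.A_nonneg k i j)
    · exact mul_le_of_le_one_left (R.B_nonneg i j) hct.1
  have hpow : ∀ n : ℕ, ∀ i j, 0 ≤ (R.M ^ n) i j ∧ c ^ n * (R.M ^ n) i j ≤ (R.Mt t ^ n) i j := by
    intro n
    induction n with
    | zero => intro i j; simp only [pow_zero, one_apply]; split_ifs <;> norm_num
    | succ n ih =>
      intro i j
      simp only [pow_succ, mul_apply]
      refine ⟨Finset.sum_nonneg fun l _ => mul_nonneg (ih i l).1 (hM.nonneg l j), ?_⟩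
      rw [Finset.mul_sum]
      refine Finset.sum_le_sum fun l _ => ?_
      calc c ^ n * c * ((R.M ^ n) i l * R.M l j) = (c ^ n * (R.M ^ n) i l) * (c * R.M l j) := by
            ring
        _ ≤ _ := mul_le_mul (ih i l).2 (hle l j) (mul_nonneg hc.le (hM.nonneg l j))
            ((mul_nonneg (pow_pos hc n).le (ih i l).1).trans (ih i l).2)
  obtain ⟨k, hk, hMk⟩ := hM.exists_pos_pow
  exact ⟨fun i j => (mul_nonneg hc.le (hM.nonneg i j)).trans (hle i j), k, hk, fun i j =>
    (mul_pos (pow_pos hc k) (hMk i j)).trans_le (hpow k i j).2⟩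

theorem continuous_Mt : Continuous R.Mt := by
  unfold Mt
  fun_prop

/-- The equations `M(t) v = x v`, `∑ v_i = const` for a normalized eigenpair `(v, x)`. -/
noncomputable def eigenpairMap (u : EuclideanSpace ℝ (Fin ℓ) × ((Fin m → ℝ) × ℝ)) :
    (Fin m → ℝ) × ℝ :=
  (R.Mt u.1 *ᵥ u.2.1 - u.2.2 • u.2.1, ∑ i, u.2.1 i)

theorem contDiff_eigenpairMap {n : ℕ∞ω} : ContDiff ℝ n R.eigenpairMap := by
  refine ContDiff.prodMk (contDiff_pi.2 fun i => ?_) (by fun_prop)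
  simp only [mulVec, dotProduct, Pi.sub_apply, Pi.smul_apply, smul_eq_mul, Mt_apply]
  have : ∀ k, ContDiff ℝ n
      fun u : EuclideanSpace ℝ (Fin ℓ) × ((Fin m → ℝ) × ℝ) => Real.exp (u.1 k) := fun k =>
    Real.contDiff_exp.comp (by fun_prop)
  fun_prop

theorem fderiv_eigenpairMap_inr (u : EuclideanSpace ℝ (Fin ℓ) × ((Fin m → ℝ) × ℝ))
    (w : Fin m → ℝ) (a : ℝ) :
    (fderiv ℝ R.eigenpairMap u ∘L .inr ℝ _ _) (w, a)
      = (R.Mt u.1 *ᵥ w - u.2.2 • w - a • u.2.1, ∑ i, w i) := by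
  obtain ⟨t, v, x⟩ := u
  have h1 : HasFDerivAt (fun q : (Fin m → ℝ) × ℝ => R.eigenpairMap (t, q))
      (fderiv ℝ R.eigenpairMap (t, v, x) ∘L .inr ℝ _ _) (v, x) :=
    ((R.contDiff_eigenpairMap.differentiable (by simp : (1 : ℕ∞ω) ≠ 0)) _).hasFDerivAt.comp _
      (hasFDerivAt_prodMk_right t (v, x))
  have h2 : HasFDerivAt (fun q : (Fin m → ℝ) × ℝ => R.eigenpairMap (t, q))
      ((((R.Mt t).mulVecLin.toContinuousLinearMap ∘L .fst ℝ _ _) -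
        (x • ContinuousLinearMap.fst ℝ (Fin m → ℝ) ℝ +
          (ContinuousLinearMap.snd ℝ (Fin m → ℝ) ℝ).smulRight v)).prod
        (∑ i, ContinuousLinearMap.proj i ∘L ContinuousLinearMap.fst ℝ (Fin m → ℝ) ℝ)) (v, x) := by
    refine HasFDerivAt.prodMk (HasFDerivAt.sub ?_ ?_) ?_
    · exact ((R.Mt t).mulVecLin.toContinuousLinearMap ∘L
        ContinuousLinearMap.fst ℝ (Fin m → ℝ) ℝ).hasFDerivAt
    · exact (hasFDerivAt_snd (𝕜 := ℝ) (p := (v, x))).smul hasFDerivAt_fst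
    · exact HasFDerivAt.fun_sum fun i _ => (ContinuousLinearMap.proj i ∘L
        ContinuousLinearMap.fst ℝ (Fin m → ℝ) ℝ).hasFDerivAt
  rw [h1.unique h2]
  simp [sub_sub]

/-- Near every point the Perron eigenvalue is analytic and there is a continuous choice of positive
eigenvectors. -/
theorem analyticAt_y_and_exists_eigenvector (hM : R.M.IsPrimitive)
    (t₀ : EuclideanSpace ℝ (Fin ℓ)) :
    AnalyticAt ℝ R.y t₀ ∧ ∃ V : EuclideanSpace ℝ (Fin ℓ) → Fin m → ℝ, ContinuousAt V t₀ ∧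
      ∀ᶠ t in 𝓝 t₀, (∀ i, 0 < V t i) ∧ R.Mt t *ᵥ V t = R.y t • V t := by
  have := R.neZero
  obtain ⟨v, hv, hTv⟩ := exists_pos_eigenvector (R.isPrimitive_Mt hM t₀)
  set u : EuclideanSpace ℝ (Fin ℓ) × ((Fin m → ℝ) × ℝ) := (t₀, v, perronValue (R.Mt t₀)) with hu
  have hcd : ContDiffAt ℝ ω R.eigenpairMap u := R.contDiff_eigenpairMap.contDiffAt
  have hker : ∀ p, (fderiv ℝ R.eigenpairMap u ∘L .inr ℝ _ _) p = 0 → p = 0 := by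
    rintro ⟨w, a⟩ hp
    rw [fderiv_eigenpairMap_inr] at hp
    obtain ⟨h1, h2⟩ := Prod.mk.inj hp
    obtain ⟨ha, b, hb⟩ := eq_smul_of_mulVec_sub_eq_smul (R.isPrimitive_Mt hM t₀) hv hTv
      (sub_eq_zero.1 h1)
    subst hb
    simp only [Pi.smul_apply, smul_eq_mul, ← Finset.mul_sum] at h2
    have : b = 0 := (mul_eq_zero.1 h2).resolve_right
      (Finset.sum_pos (fun i _ => hv i) Finset.univ_nonempty).ne'
    rw [ha, this, zero_smul]
    rfl
  have hinj : Function.Injective (fderiv ℝ R.eigenpairMap u ∘L .inr ℝ _ _) :=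
    (injective_iff_map_eq_zero _).2 hker
  -- The normalization ∑ v_i makes the unknowns and the equations equal in number, so injectivity of
  -- the partial derivative suffices.
  have hinv : (fderiv ℝ R.eigenpairMap u ∘L .inr ℝ _ _).IsInvertible :=
    ⟨(LinearEquiv.ofInjectiveEndo _ hinj).toContinuousLinearEquiv, by ext <;> rfl⟩
  set ψ := hcd.implicitFunction (by simp) hinv with hψ
  have hψu : ψ t₀ = (v, perronValue (R.Mt t₀)) := hcd.implicitFunction_apply_self (by simp) hinv
  have hψc : ContDiffAt ℝ ω ψ t₀ := hcd.contDiffAt_implicitFunction (by simp) hinv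
  have hψe : ∀ᶠ t in 𝓝 t₀, R.eigenpairMap (t, ψ t) = R.eigenpairMap u :=
    hcd.eventually_apply_implicitFunction (by simp) hinv
  have hV : ContinuousAt (fun t => (ψ t).1) t₀ := hψc.continuousAt.fst
  have hpos : ∀ᶠ t in 𝓝 t₀, ∀ i, 0 < (ψ t).1 i := by
    rw [eventually_all]
    intro i
    refine ((continuousAt_apply i _).comp hV).eventually (lt_mem_nhds ?_)
    simpa [hψu] using hv i
  have heig : ∀ᶠ t in 𝓝 t₀, (∀ i, 0 < (ψ t).1 i) ∧ R.Mt t *ᵥ (ψ t).1 = (ψ t).2 • (ψ t).1 ∧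
      R.y t = (ψ t).2 := by
    filter_upwards [hψe, hpos] with t ht hpt
    have h0 : R.eigenpairMap u = (0, ∑ i, v i) := by
      simp only [eigenpairMap, hu]
      rw [hTv, sub_self]
    rw [h0] at ht
    have h1 := sub_eq_zero.1 (Prod.mk.inj ht).1
    exact ⟨hpt, h1, perronValue_eq_of_pos_eigenvector (R.isPrimitive_Mt hM t) hpt h1⟩
  refine ⟨?_, fun t => (ψ t).1, hV, ?_⟩
  · have : AnalyticAt ℝ (fun t => (ψ t).2) t₀ := hψc.snd.analyticAt
    exact this.congr (heig.mono fun t ht => ht.2.2.symm)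
  · filter_upwards [heig] with t ht
    exact ⟨ht.1, by rw [ht.2.2]; exact ht.2.1⟩

end LinearRepresentation

/-! ### From moment generating functions to convergence in distribution. -/

section ConvergenceOfMGF

variable {E : Type*} [NormedAddCommGroup E] [InnerProductSpace ℝ E]
  [MeasurableSpace E] {α : Type*} {l : Filter α}

/-- The exponential moment at 2t controls the truncation error at t uniformly along the filter; this
replaces uniform integrability. -/
theorem exp_sub_min_le (a : ℝ) {K : ℝ} (hK : 0 < K) :
    Real.exp a - min (Real.exp a) K ≤ Real.exp (2 * a) / K := by
  have h2 : Real.exp (2 * a) = Real.exp a * Real.exp a := by rw [two_mul, Real.exp_add]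
  rcases le_total (Real.exp a) K with h | h
  · rw [min_eq_left h, sub_self]
    positivity
  · rw [min_eq_right h, le_div_iff₀ hK, h2]
    nlinarith [Real.exp_pos a]

/-- Weak limits of measures with convergent moment generating functions have the limit as moment
generating function. -/
theorem integral_exp_inner_of_tendsto [BorelSpace E] [l.NeBot] {μ : α → ProbabilityMeasure E}
    {μ' : ProbabilityMeasure E} (hμ : Tendsto μ l (𝓝 μ')) {L : E → ℝ}
    (hint : ∀ a t, Integrable (fun x => Real.exp (inner ℝ t x)) (μ a : Measure E))
    (h : ∀ t, Tendsto (fun a => ∫ x, Real.exp (inner ℝ t x) ∂(μ a : Measure E)) l (𝓝 (L t)))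
    (t : E) : ∫ x, Real.exp (inner ℝ t x) ∂(μ' : Measure E) = L t := by
  set X : E → ℝ := fun x => Real.exp (inner ℝ t x) with hX
  have hXc : Continuous X := by fun_prop
  have hX0 : ∀ x, 0 ≤ X x := fun x => (Real.exp_pos _).le
  let g : ℕ → BoundedContinuousFunction E ℝ := fun K =>
    BoundedContinuousFunction.ofNormedAddCommGroup (fun x => min (X x) (K + 1 : ℝ))
      (hXc.min continuous_const) (K + 1) fun x => by
        rw [Real.norm_of_nonneg (le_min (hX0 x) (by positivity))]
        exact min_le_right _ _
  have hg : ∀ K x, g K x = min (X x) (K + 1 : ℝ) := fun K x => rfl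
  have hg0 : ∀ K x, 0 ≤ g K x := fun K x => le_min (hX0 x) (by positivity)
  have hgX : ∀ K x, g K x ≤ X x := fun K x => min_le_left _ _
  have hgi : ∀ (K : ℕ) (ν : ProbabilityMeasure E), Integrable (g K) (ν : Measure E) :=
    fun K ν => BoundedContinuousFunction.integrable _ _
  have hgμ : ∀ K, Tendsto (fun a => ∫ x, g K x ∂(μ a : Measure E)) l
      (𝓝 (∫ x, g K x ∂(μ' : Measure E))) := fun K =>
    ProbabilityMeasure.tendsto_iff_forall_integral_tendsto.1 hμ (g K)
  have hupper : ∀ K, ∫ x, g K x ∂(μ' : Measure E) ≤ L t := fun K =>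
    le_of_tendsto_of_tendsto' (hgμ K) (h t) fun a =>
      integral_mono (hgi K (μ a)) (hint a t) (hgX K)
  have hlower : ∀ K : ℕ, L t - L ((2 : ℝ) • t) / (K + 1) ≤ ∫ x, g K x ∂(μ' : Measure E) := by
    intro K
    refine le_of_tendsto_of_tendsto' ((h t).sub ((h ((2 : ℝ) • t)).div_const _)) (hgμ K)
      fun a => ?_
    rw [sub_le_comm, ← integral_sub (hint a t) (hgi K (μ a)), ← integral_div]
    refine integral_mono ((hint a t).sub (hgi K (μ a))) ((hint a _).div_const _) fun x => ?_
    simp only [inner_smul_left, RCLike.conj_to_real]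
    exact exp_sub_min_le _ (by positivity)
  have hlim1 : Tendsto (fun K : ℕ => ∫ x, g K x ∂(μ' : Measure E)) atTop (𝓝 (L t)) := by
    refine tendsto_of_tendsto_of_tendsto_of_le_of_le ?_ tendsto_const_nhds hlower hupper
    have : Tendsto (fun K : ℕ => L ((2 : ℝ) • t) / ((K : ℝ) + 1)) atTop (𝓝 0) :=
      tendsto_const_nhds.div_atTop
        (tendsto_natCast_atTop_atTop.atTop_add tendsto_const_nhds)
    simpa using this.const_sub (L t)
  have hgt : ∀ x, Tendsto (fun K : ℕ => g K x) atTop (𝓝 (X x)) := by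
    intro x
    refine tendsto_atTop_of_eventually_const (i₀ := ⌈X x⌉₊) fun K hK => ?_
    rw [hg, min_eq_left]
    have h1 : X x ≤ ⌈X x⌉₊ := Nat.le_ceil _
    have h2 : (⌈X x⌉₊ : ℝ) ≤ K := by exact_mod_cast hK
    linarith
  -- The bound `hupper` and monotone convergence give integrability under the limit; dominated
  -- convergence can then be used.
  have hXi : Integrable X (μ' : Measure E) := by
    refine ⟨hXc.aestronglyMeasurable, ?_⟩
    rw [hasFiniteIntegral_iff_ofReal (ae_of_all _ hX0)]
    have h1 : Tendsto (fun K : ℕ => ∫⁻ x, ENNReal.ofReal (g K x) ∂(μ' : Measure E)) atTop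
        (𝓝 (∫⁻ x, ENNReal.ofReal (X x) ∂(μ' : Measure E))) := by
      refine lintegral_tendsto_of_tendsto_of_monotone
        (fun K => (g K).continuous.measurable.ennreal_ofReal.aemeasurable) ?_ ?_
      · refine ae_of_all _ fun x K K' hKK => ENNReal.ofReal_le_ofReal ?_
        rw [hg, hg]
        have : (K : ℝ) ≤ K' := by exact_mod_cast hKK
        exact min_le_min_left _ (by linarith)
      · exact ae_of_all _ fun x => (ENNReal.continuous_ofReal.tendsto _).comp (hgt x)
    refine (le_of_tendsto' h1 fun K => ?_).trans_lt (ENNReal.ofReal_lt_top (r := L t))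
    rw [← ofReal_integral_eq_lintegral_ofReal (hgi K μ') (ae_of_all _ (hg0 K))]
    exact ENNReal.ofReal_le_ofReal (hupper K)
  have hlim2 : Tendsto (fun K : ℕ => ∫ x, g K x ∂(μ' : Measure E)) atTop
      (𝓝 (∫ x, X x ∂(μ' : Measure E))) := by
    refine tendsto_integral_of_dominated_convergence X
      (fun K => (g K).continuous.aestronglyMeasurable) hXi (fun K => ae_of_all _ fun x => ?_)
      (ae_of_all _ hgt)
    rw [Real.norm_of_nonneg (hg0 K x)]
    exact hgX K x
  exact tendsto_nhds_unique hlim2 hlim1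

/-- A measure on a Euclidean space is determined by its moment generating function, if that of one
of the two measures is finite everywhere. -/
theorem ext_of_integral_exp_inner [FiniteDimensional ℝ E] [BorelSpace E] {μ ν : Measure E}
    [IsProbabilityMeasure μ] [IsProbabilityMeasure ν] (hν : ∀ t, Integrable (fun x => Real.exp (inner ℝ t x)) ν)
    (h : ∀ t, ∫ x, Real.exp (inner ℝ t x) ∂μ = ∫ x, Real.exp (inner ℝ t x) ∂ν) : μ = ν := by
  refine Measure.ext_of_charFun (funext fun t => ?_)
  have hmgf : mgf (fun x => inner ℝ t x) ν = mgf (fun x => inner ℝ t x) μ := by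
    ext s
    have := h (s • t)
    simp only [inner_smul_left, RCLike.conj_to_real] at this
    exact this.symm
  have huniv : integrableExpSet (fun x => inner ℝ t x) ν = Set.univ := by
    refine Set.eq_univ_of_forall fun s => ?_
    have := hν (s • t)
    simp only [inner_smul_left, RCLike.conj_to_real] at this
    exact this
  -- Analytic continuation from the real axis: the strip of convergence is the whole plane, and the
  -- value at I is the characteristic function.
  have := eqOn_complexMGF_of_mgf hmgf (x := Complex.I) (by simp [huniv])
  simp only [complexMGF] at this
  simp only [charFun_apply]
  calc _ = ∫ x, Complex.exp (Complex.I * ↑(inner ℝ t x)) ∂μ := by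
        congr with x; rw [real_inner_comm, mul_comm]
    _ = _ := this.symm
    _ = _ := by congr with x; rw [real_inner_comm, mul_comm]

/-- Chernoff bounds with exponents 1 and -1 along each basis vector give uniformly exponential
tails. -/
theorem isTightMeasureSet_of_integral_exp_inner_le [FiniteDimensional ℝ E] {ι : Type*} [Fintype ι]
    (b : OrthonormalBasis ι ℝ E) {S : Set (Measure E)} (hS : ∀ μ ∈ S, IsProbabilityMeasure μ)
    {C : ℝ} (hint : ∀ μ ∈ S, ∀ t, Integrable (fun x => Real.exp (inner ℝ t x)) μ)
    (hC : ∀ μ ∈ S, ∀ i, ∫ x, Real.exp (inner ℝ (b i) x) ∂μ ≤ C ∧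
      ∫ x, Real.exp (inner ℝ (-b i) x) ∂μ ≤ C) : IsTightMeasureSet S := by
  refine isTightMeasureSet_of_forall_basis_tendsto b fun i => ?_
  have hlim : Tendsto (fun r : ℝ => ENNReal.ofReal (Real.exp (-r) * (2 * C))) atTop (𝓝 0) := by
    rw [← ENNReal.ofReal_zero]
    refine (ENNReal.continuous_ofReal.tendsto _).comp ?_
    simpa using (Real.tendsto_exp_neg_atTop_nhds_zero).mul_const (2 * C)
  refine tendsto_of_tendsto_of_tendsto_of_le_of_le tendsto_const_nhds hlim (fun _ => zero_le)
    fun r => iSup₂_le fun μ hμ => ?_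
  have := hS μ hμ
  have h1 := measure_ge_le_exp_mul_mgf (μ := μ) (X := fun x => inner ℝ (b i) x) (t := 1) r
    zero_le_one (by simpa using hint μ hμ (b i))
  have h2 := measure_le_le_exp_mul_mgf (μ := μ) (X := fun x => inner ℝ (b i) x) (t := -1) (-r)
    (by norm_num) (by simpa [inner_neg_left] using hint μ hμ (-b i))
  have h3 := hC μ hμ i
  simp only [inner_neg_left] at h3
  simp only [mgf, one_mul, neg_mul, neg_neg, one_mul] at h1 h2
  have hle : μ.real {x | r < ‖inner ℝ (b i) x‖} ≤ Real.exp (-r) * (2 * C) := by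
    calc _ ≤ μ.real ({x | r ≤ inner ℝ (b i) x} ∪ {x | inner ℝ (b i) x ≤ -r}) := by
          refine measureReal_mono fun x hx => ?_
          rcases lt_abs.1 (show r < |inner ℝ (b i) x| from hx) with h | h
          · exact Or.inl h.le
          · exact Or.inr (by simp only [Set.mem_ofPred_eq]; linarith)
      _ ≤ _ := measureReal_union_le _ _
      _ ≤ Real.exp (-r) * C + Real.exp (-r) * C := by
          refine add_le_add (h1.trans ?_) (h2.trans ?_)
          · exact mul_le_mul_of_nonneg_left h3.1 (Real.exp_pos _).le
          · exact mul_le_mul_of_nonneg_left h3.2 (Real.exp_pos _).le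
      _ = _ := by ring
  rw [← ENNReal.ofReal_toReal (measure_ne_top μ _)]
  exact ENNReal.ofReal_le_ofReal hle

/-- Convergence of moment generating functions implies convergence in distribution. -/
theorem tendsto_of_tendsto_integral_exp_inner [FiniteDimensional ℝ E] [BorelSpace E]
    {μ : α → ProbabilityMeasure E} {ν : ProbabilityMeasure E}
    (hint : ∀ a t, Integrable (fun x => Real.exp (inner ℝ t x)) (μ a : Measure E))
    (hν : ∀ t, Integrable (fun x => Real.exp (inner ℝ t x)) (ν : Measure E))
    (h : ∀ t, Tendsto (fun a => ∫ x, Real.exp (inner ℝ t x) ∂(μ a : Measure E)) l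
      (𝓝 (∫ x, Real.exp (inner ℝ t x) ∂(ν : Measure E)))) :
    Tendsto μ l (𝓝 ν) := by
  set b := stdOrthonormalBasis ℝ E
  set L : E → ℝ := fun t => ∫ x, Real.exp (inner ℝ t x) ∂(ν : Measure E)
  obtain ⟨C, hC⟩ : ∃ C, ∀ i, L (b i) < C ∧ L (-b i) < C := by
    obtain ⟨C₁, h₁⟩ := (Set.finite_range fun i => max (L (b i)) (L (-b i))).bddAbove
    refine ⟨C₁ + 1, fun i => ?_⟩
    have := max_le_iff.1 (h₁ ⟨i, rfl⟩)
    constructor <;> linarith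
  set A : Set α := {a | ∀ i, ∫ x, Real.exp (inner ℝ (b i) x) ∂(μ a : Measure E) ≤ C ∧
      ∫ x, Real.exp (inner ℝ (-b i) x) ∂(μ a : Measure E) ≤ C}
  have hA : A ∈ l := by
    refine eventually_all.2 fun i => ?_
    exact (((h (b i)).eventually (gt_mem_nhds (hC i).1)).mono fun _ h => h.le).and
      (((h (-b i)).eventually (gt_mem_nhds (hC i).2)).mono fun _ h => h.le)
  have hcomp : IsCompact (closure (μ '' A)) := by
    refine isCompact_closure_of_isTightMeasureSet
      (isTightMeasureSet_of_integral_exp_inner_le b (C := C) ?_ ?_ ?_)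
    · rintro _ ⟨ρ, -, rfl⟩; infer_instance
    · rintro _ ⟨_, ⟨a, -, rfl⟩, rfl⟩; exact hint a
    · rintro _ ⟨_, ⟨a, ha, rfl⟩, rfl⟩; exact ha
  -- The set A belongs to l, so along every ultrafilter finer than l compactness yields a limit,
  -- which its moment generating function identifies as ν.
  refine (tendsto_iff_ultrafilter _ _ _).2 fun U hU => ?_
  obtain ⟨μ', -, hμ'⟩ := hcomp.ultrafilter_le_nhds (U.map μ)
    (le_principal_iff.2 (mem_of_superset (Filter.image_mem_map (hU hA)) subset_closure))
  have hμ'' : Tendsto μ U (𝓝 μ') := hμ'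
  have heq : μ' = ν := by
    have := μ'.2
    have := ν.2
    refine Subtype.ext (ext_of_integral_exp_inner (μ := (μ' : Measure E)) (ν := (ν : Measure E)) hν
      fun t => ?_)
    exact integral_exp_inner_of_tendsto hμ'' (L := L) hint (fun t => (h t).mono_left hU) t
  exact heq ▸ hμ''

end ConvergenceOfMGF

/-! ### Moment generating function of the multivariate Gaussian. -/

section Gaussian

variable {ι : Type*} [Fintype ι] [DecidableEq ι] {S : Matrix ι ι ℝ}

theorem map_inner_multivariateGaussian (hS : S.PosSemidef) (t : EuclideanSpace ℝ ι) :
    (multivariateGaussian 0 S).map (fun x => inner ℝ t x)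
      = gaussianReal 0 (t.ofLp ⬝ᵥ (S *ᵥ t.ofLp)).toNNReal := by
  have h := IsGaussian.map_eq_gaussianReal (μ := multivariateGaussian 0 S) (innerSL ℝ t)
  have h1 : ∫ x, (innerSL ℝ t) x ∂(multivariateGaussian 0 S) = 0 := by
    rw [ContinuousLinearMap.integral_comp_comm _ IsGaussian.integrable_fun_id,
      integral_id_multivariateGaussian, map_zero]
  have h2 : Var[innerSL ℝ t; multivariateGaussian 0 S] = t.ofLp ⬝ᵥ (S *ᵥ t.ofLp) := by
    rw [← covarianceBilin_multivariateGaussian (μ := 0) hS t t,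
      covarianceBilin_self IsGaussian.memLp_two_id]
    rfl
  rw [h1, h2] at h
  exact h

theorem integrable_exp_inner_multivariateGaussian (hS : S.PosSemidef) (t : EuclideanSpace ℝ ι) :
    Integrable (fun x => Real.exp (inner ℝ t x)) (multivariateGaussian 0 S) := by
  have h := integrable_exp_mul_gaussianReal (μ := 0)
    (v := (t.ofLp ⬝ᵥ (S *ᵥ t.ofLp)).toNNReal) 1
  rw [← map_inner_multivariateGaussian hS t, integrable_map_measure (by fun_prop) (by fun_prop)] at h
  simpa [Function.comp_def] using h

theorem integral_exp_inner_multivariateGaussian (hS : S.PosSemidef) (t : EuclideanSpace ℝ ι) :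
    ∫ x, Real.exp (inner ℝ t x) ∂(multivariateGaussian 0 S)
      = Real.exp (1 / 2 * (t.ofLp ⬝ᵥ (S *ᵥ t.ofLp))) := by
  have h := mgf_gaussianReal (map_inner_multivariateGaussian hS t) 1
  have h0 : 0 ≤ t.ofLp ⬝ᵥ (S *ᵥ t.ofLp) := by
    simpa using hS.dotProduct_mulVec_nonneg t.ofLp
  simp only [mgf, one_mul, zero_add, one_pow, mul_one, Real.coe_toNNReal _ h0] at h
  rw [h]
  ring_nf

end Gaussian

/-! ### Generating functions of words and their asymptotics. -/

/-- Expanding the power keeps the factors in order, so the letters' matrices need not commute. -/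
theorem sum_prod_map_ofFn {A S : Type*} [Fintype A] [Semiring S] (L : A → S) (n : ℕ) :
    ∑ w : Fin n → A, ((List.ofFn w).map L).prod = (∑ a, L a) ^ n := by
  induction n with
  | zero => simp
  | succ n ih =>
    rw [pow_succ', ← ih, Finset.sum_mul_sum, ← Fintype.sum_prod_type']
    refine (Fintype.sum_equiv (Fin.consEquiv fun _ => A) _ _ fun p => ?_).symm
    simp [Fin.consEquiv, List.ofFn_succ]

theorem prod_map_smul {A S : Type*} [Semiring S] [Algebra ℝ S] (e : A → ℝ) (L : A → S)
    (x : List A) : (x.map fun a => e a • L a).prod = (x.map e).prod • (x.map L).prod := by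
  induction x with
  | nil => simp
  | cons a x ih => simp [ih, smul_smul, mul_comm]

/-- The weight `e^{s_i}` of the letter `a_i`, and `1` of the letter `b`. -/
noncomputable def letterWeight {ℓ : ℕ} (s : EuclideanSpace ℝ (Fin ℓ)) (a : Letter ℓ) : ℝ :=
  a.elim 1 fun i => Real.exp (s i)

theorem prod_map_letterWeight {ℓ : ℕ} (s : EuclideanSpace ℝ (Fin ℓ)) (x : List (Letter ℓ)) :
    (x.map (letterWeight s)).prod = Real.exp (∑ i, s i * (x.count (some i) : ℝ)) := by
  induction x with
  | nil => simp
  | cons a x ih =>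
    rw [List.map_cons, List.prod_cons, ih]
    cases a with
    | none => simp [letterWeight]
    | some j =>
      simp only [letterWeight, Option.elim_some, ← Real.exp_add, List.count_cons, beq_iff_eq,
        Option.some.injEq]
      congr 1
      push_cast
      simp [mul_add, Finset.sum_add_distrib, add_comm]

namespace LinearRepresentation

variable {ℓ m : ℕ} (R : LinearRepresentation ℓ m)

theorem coeff_toFree {n : ℕ} (w : Word ℓ n) :
    R.coeff w.toFree = R.ξ ⬝ᵥ (((List.ofFn w).map R.letterMatrix).prod *ᵥ R.η) := by
  rw [coeff, mu, FreeMonoid.lift_apply]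
  rfl

/-- The generating function `∑_{|w| = n} (r, w) e^{s · Y(w)}`. -/
theorem sum_exp_inner_mul_coeff (s : EuclideanSpace ℝ (Fin ℓ)) (n : ℕ) :
    ∑ w : Word ℓ n, Real.exp (inner ℝ s w.Y) * R.coeff w.toFree
      = R.ξ ⬝ᵥ ((R.Mt s ^ n) *ᵥ R.η) := by
  have h1 : ∑ a, letterWeight s a • R.letterMatrix a = R.Mt s := by
    rw [Fintype.sum_option, add_comm]
    simp [letterWeight, letterMatrix, Mt]
  have h2 : ∀ w : Word ℓ n, Real.exp (inner ℝ s w.Y) * R.coeff w.toFree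
      = R.ξ ⬝ᵥ (((List.ofFn w).map fun a => letterWeight s a • R.letterMatrix a).prod *ᵥ R.η) := by
    intro w
    rw [prod_map_smul, prod_map_letterWeight, smul_mulVec, dotProduct_smul, smul_eq_mul,
      coeff_toFree]
    simp only [Word.Y, PiLp.inner_apply, RCLike.inner_apply, conj_trivial, mul_comm]
  rw [Finset.sum_congr rfl fun w _ => h2 w, ← dotProduct_sum, ← sum_mulVec, ← h1,
    ← sum_prod_map_ofFn]
  rfl

theorem sum_coeff (n : ℕ) :
    ∑ w : Word ℓ n, R.coeff w.toFree = R.ξ ⬝ᵥ ((R.Mt 0 ^ n) *ᵥ R.η) := by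
  simpa using R.sum_exp_inner_mul_coeff 0 n

theorem integral_wordMeasure {n : R.lengths} (f : Word ℓ n → ℝ) :
    ∫ w, f w ∂(R.wordMeasure n)
      = (∑ w, f w * R.coeff w.toFree) / ∑ w : Word ℓ n, R.coeff w.toFree := by
  have : DiscreteMeasurableSpace (Word ℓ n) := ⟨fun _ => trivial⟩
  have hpos := R.sum_coeff_pos n.2
  rw [wordMeasure, PMF.integral_eq_sum, Finset.sum_div]
  refine Finset.sum_congr rfl fun w _ => ?_
  rw [wordPMF, PMF.ofFintype_apply, ENNReal.toReal_ofReal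
    (div_nonneg (R.coeff_nonneg _) hpos.le), smul_eq_mul]
  ring

theorem integrable_wordMeasure {n : R.lengths} (f : Word ℓ n → ℝ) :
    Integrable f (R.wordMeasure n) := by
  have : DiscreteMeasurableSpace (Word ℓ n) := ⟨fun _ => trivial⟩
  exact .of_finite

/-- The moment generating function of the normalized counts. -/
theorem integral_exp_inner_normalizedY (n : R.lengths) (t : EuclideanSpace ℝ (Fin ℓ)) :
    ∫ w, Real.exp (inner ℝ t (R.normalizedY n w)) ∂(R.wordMeasure n)
      = Real.exp (-(Real.sqrt (n : ℕ) * inner ℝ t R.β))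
        * ((R.ξ ⬝ᵥ ((R.Mt ((Real.sqrt (n : ℕ))⁻¹ • t) ^ (n : ℕ)) *ᵥ R.η))
          / (R.ξ ⬝ᵥ ((R.Mt 0 ^ (n : ℕ)) *ᵥ R.η))) := by
  rw [integral_wordMeasure, ← sum_exp_inner_mul_coeff, ← sum_coeff, ← mul_div_assoc,
    Finset.mul_sum]
  congr 1
  refine Finset.sum_congr rfl fun w _ => ?_
  rw [← mul_assoc, ← Real.exp_add]
  congr 2
  have hs : (Real.sqrt (n : ℕ))⁻¹ * ((n : ℕ) : ℝ) = Real.sqrt (n : ℕ) := by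
    rw [inv_mul_eq_div, Real.div_sqrt]
  rw [normalizedY, inner_smul_right, inner_sub_right, inner_smul_right, inner_smul_left,
    RCLike.conj_to_real, mul_sub, ← mul_assoc, hs]
  ring

theorem y_pos (hM : R.M.IsPrimitive) (t : EuclideanSpace ℝ (Fin ℓ)) : 0 < R.y t := by
  have := R.neZero
  exact (isPerronEigenvalue_perronValue (R.isPrimitive_Mt hM t)).1

/-- `ξ' M(s_n)^n η ~ C y(s_n)^n` whenever `s_n → 0`, with `C` independent of the sequence. -/
theorem exists_tendsto_dotProduct_div_pow (hM : R.M.IsPrimitive) (hξ : ∃ i, 0 < R.ξ i)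
    (hη : ∃ i, 0 < R.η i) :
    ∃ C > 0, ∀ {α : Type} {l : Filter α} {N : α → ℕ} {s : α → EuclideanSpace ℝ (Fin ℓ)},
      Tendsto N l atTop → Tendsto s l (𝓝 0) →
      Tendsto (fun a => (R.ξ ⬝ᵥ ((R.Mt (s a) ^ N a) *ᵥ R.η)) / R.y (s a) ^ N a) l (𝓝 C) := by
  have := R.neZero
  obtain ⟨hy, V, hV, hVe⟩ := R.analyticAt_y_and_exists_eigenvector hM 0
  have hyc := hy.continuousAt
  obtain ⟨hV0, hV0e⟩ := hVe.self_of_nhds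
  have hT := R.isPrimitive_Mt hM
  have hstoch : ∀ t, (∀ i, 0 < V t i) → R.Mt t *ᵥ V t = R.y t • V t →
      doob (R.Mt t) (V t) (R.y t) ∈ rowStochastic ℝ (Fin m) := fun t h1 h2 =>
    doob_mem_rowStochastic (hT t).nonneg h1 (R.y_pos hM t) h2
  obtain ⟨k, hk⟩ := doob_pow_pos (hT 0) hV0 (R.y_pos hM 0)
  obtain ⟨c, hc, hlim⟩ := exists_tendsto_pow_mulVec (hstoch 0 hV0 hV0e) hk
    (f := fun j => R.η j / V 0 j) (fun i => div_nonneg (R.η_nonneg i) (hV0 i).le)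
    (hη.imp fun i hi => div_pos hi (hV0 i))
  -- Undoing the Doob transform, coordinate i of M(s)^N η / y(s)^N is V_i(s) times a quantity
  -- tending to c.
  refine ⟨∑ i, R.ξ i * (V 0 i * c), ?_, ?_⟩
  · obtain ⟨i, hi⟩ := hξ
    exact Finset.sum_pos' (fun j _ => mul_nonneg (R.ξ_nonneg j) (mul_pos (hV0 j) hc).le)
      ⟨i, Finset.mem_univ i, mul_pos hi (mul_pos (hV0 i) hc)⟩
  intro α l N s hN hs
  have hVi : ∀ i, Tendsto (fun a => V (s a) i) l (𝓝 (V 0 i)) := fun i =>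
    tendsto_pi_nhds.1 (hV.tendsto.comp hs) i
  have hys : Tendsto (fun a => R.y (s a)) l (𝓝 (R.y 0)) := hyc.tendsto.comp hs
  have hQ : Tendsto (fun a => doob (R.Mt (s a)) (V (s a)) (R.y (s a))) l
      (𝓝 (doob (R.Mt 0) (V 0) (R.y 0))) := by
    refine tendsto_pi_nhds.2 fun i => tendsto_pi_nhds.2 fun j => ?_
    have hMij : Tendsto (fun a => R.Mt (s a) i j) l (𝓝 (R.Mt 0 i j)) :=
      tendsto_pi_nhds.1 (tendsto_pi_nhds.1 ((R.continuous_Mt.tendsto 0).comp hs) i) j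
    exact (hMij.mul (hVi j)).div (hys.mul (hVi i)) (mul_pos (R.y_pos hM 0) (hV0 i)).ne'
  have hg : Tendsto (fun a j => R.η j / V (s a) j) l (𝓝 fun j => R.η j / V 0 j) :=
    tendsto_pi_nhds.2 fun j => tendsto_const_nhds.div (hVi j) (hV0 j).ne'
  have hmain := hlim ((hs.eventually hVe).mono fun a ha => hstoch _ ha.1 ha.2) hQ hg hN
  refine (tendsto_finsetSum Finset.univ fun i _ =>
    ((hVi i).mul (hmain i)).const_mul (R.ξ i)).congr' ?_
  filter_upwards [hs.eventually hVe] with a ha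
  have hya := (pow_pos (R.y_pos hM (s a)) (N a)).ne'
  rw [dotProduct, eq_div_iff hya, Finset.sum_mul]
  refine Finset.sum_congr rfl fun i _ => ?_
  rw [pow_mulVec_eq_doob (T := R.Mt (s a)) (η := R.η) ha.1 (R.y_pos hM (s a))]
  ring

theorem analyticOnNhd_y (hM : R.M.IsPrimitive) : AnalyticOnNhd ℝ R.y Set.univ := fun t _ =>
  (R.analyticAt_y_and_exists_eigenvector hM t).1

end LinearRepresentation

/-! ### Taylor expansion and Hessians. -/

section SecondOrder

variable {E : Type*} [NormedAddCommGroup E] [NormedSpace ℝ E]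

/-- The second order Taylor expansion along `t / √n`. -/
theorem tendsto_mul_sub_sqrt_mul_fderiv {f : E → ℝ} (hf : ContDiff ℝ 2 f) (t : E) :
    Tendsto (fun n : ℕ => (n : ℝ) * (f ((Real.sqrt n)⁻¹ • t) - f 0)
      - Real.sqrt n * fderiv ℝ f 0 t) atTop (𝓝 (1 / 2 * fderiv ℝ (fderiv ℝ f) 0 t t)) := by
  set φ : ℝ → ℝ := fun x => f (x • t) with hφ
  have hφc : ContDiff ℝ 2 φ := hf.comp (by fun_prop)
  have hline : ∀ x : ℝ, HasDerivAt (fun x : ℝ => x • t) t x := fun x => by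
    simpa using (hasDerivAt_id x).smul_const t
  have hφ1 : ∀ x, HasDerivAt φ (fderiv ℝ f (x • t) t) x := fun x =>
    ((hf.differentiable (by norm_num) (x • t)).hasFDerivAt).comp_hasDerivAt x (hline x)
  have hd1 : deriv φ = fun x => fderiv ℝ f (x • t) t := funext fun x => (hφ1 x).deriv
  have hf' : Differentiable ℝ (fderiv ℝ f) :=
    (hf.fderiv_right (m := 1) (by norm_num)).differentiable (by norm_num)
  have hd2 : deriv (deriv φ) 0 = fderiv ℝ (fderiv ℝ f) 0 t t := by
    rw [hd1]
    have h1 := ((hf' ((0 : ℝ) • t)).hasFDerivAt).comp_hasDerivAt (0 : ℝ) (hline 0)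
    have h2 := (h1.clm_apply (hasDerivAt_const (0 : ℝ) t)).deriv
    simpa using h2
  have ht := taylor_isLittleO_univ (f := φ) (x₀ := 0) (n := 2) (by exact_mod_cast hφc)
  have hexp : ∀ x, taylorWithinEval φ 2 Set.univ 0 x
      = f 0 + x * fderiv ℝ f 0 t + x ^ 2 / 2 * fderiv ℝ (fderiv ℝ f) 0 t t := by
    intro x
    rw [taylorWithinEval_succ, taylorWithinEval_succ, taylor_within_zero_eval]
    simp only [iteratedDerivWithin_univ, zero_add, iteratedDeriv_one]
    rw [iteratedDeriv_succ, iteratedDeriv_one, hd2, hd1]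
    simp only [hφ, zero_smul, smul_eq_mul]
    norm_num [Nat.factorial]
    exact Or.inl (by ring)
  have hsq : Tendsto (fun n : ℕ => (Real.sqrt n)⁻¹) atTop (𝓝 0) :=
    tendsto_inv_atTop_zero.comp (Real.tendsto_sqrt_atTop.comp tendsto_natCast_atTop_atTop)
  have h0 := (ht.comp_tendsto hsq).tendsto_div_nhds_zero
  refine tendsto_sub_nhds_zero_iff.1 (h0.congr' ?_)
  filter_upwards [eventually_gt_atTop 0] with n hn
  have hn' : (0 : ℝ) < n := by exact_mod_cast hn
  have hs2 := Real.sq_sqrt hn'.le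
  simp only [Function.comp, hexp, sub_zero]
  simp only [hφ]
  rw [inv_pow, hs2, div_inv_eq_mul]
  have e1 : (Real.sqrt n)⁻¹ * n = Real.sqrt n := by rw [inv_mul_eq_div, Real.div_sqrt]
  have e2 : (n : ℝ)⁻¹ * n = 1 := inv_mul_cancel₀ hn'.ne'
  linear_combination (-fderiv ℝ f 0 t) * e1
    - (1 / 2 * fderiv ℝ (fderiv ℝ f) 0 t t) * e2

variable {ℓ : ℕ}

theorem pderiv_eq_fderiv {f : EuclideanSpace ℝ (Fin ℓ) → ℝ} {s : EuclideanSpace ℝ (Fin ℓ)}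
    (hf : DifferentiableAt ℝ f s) (i : Fin ℓ) :
    pderiv i f s = fderiv ℝ f s (EuclideanSpace.single i 1) :=
  hf.lineDeriv_eq_fderiv

theorem hessian_eq_fderiv_fderiv {f : EuclideanSpace ℝ (Fin ℓ) → ℝ} (hf : ContDiff ℝ 2 f)
    (s : EuclideanSpace ℝ (Fin ℓ)) (i j : Fin ℓ) :
    hessian f s i j = fderiv ℝ (fderiv ℝ f) s (EuclideanSpace.single i 1)
      (EuclideanSpace.single j 1) := by
  have h1 : pderiv j f = fun s => fderiv ℝ f s (EuclideanSpace.single j 1) := funext fun s =>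
    pderiv_eq_fderiv (hf.differentiable (by norm_num) s) j
  have hf' : Differentiable ℝ (fderiv ℝ f) :=
    (hf.fderiv_right (m := 1) (by norm_num)).differentiable (by norm_num)
  rw [hessian, of_apply, h1, pderiv_eq_fderiv ((hf' s).clm_apply (differentiableAt_const _)),
    fderiv_clm_apply (hf' s) (differentiableAt_const _)]
  simp

theorem sum_smul_single (t : EuclideanSpace ℝ (Fin ℓ)) :
    ∑ i, t i • EuclideanSpace.single i (1 : ℝ) = t := by
  ext j
  simp [Finset.sum_apply, Pi.single_apply]

theorem dotProduct_hessian_mulVec {f : EuclideanSpace ℝ (Fin ℓ) → ℝ} (hf : ContDiff ℝ 2 f)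
    (s t : EuclideanSpace ℝ (Fin ℓ)) :
    t.ofLp ⬝ᵥ (hessian f s *ᵥ t.ofLp) = fderiv ℝ (fderiv ℝ f) s t t := by
  conv_rhs => rw [← sum_smul_single t]
  simp only [map_sum, map_smul, _root_.sum_apply, _root_.smul_apply,
    smul_eq_mul, dotProduct, mulVec, hessian_eq_fderiv_fderiv hf, Finset.mul_sum]
  rw [Finset.sum_comm]
  exact Finset.sum_congr rfl fun i _ => Finset.sum_congr rfl fun j _ => by ring

theorem isHermitian_hessian {f : EuclideanSpace ℝ (Fin ℓ) → ℝ} (hf : ContDiff ℝ 2 f)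
    (s : EuclideanSpace ℝ (Fin ℓ)) : (hessian f s).IsHermitian := by
  ext i j
  rw [conjTranspose_apply, star_trivial, hessian_eq_fderiv_fderiv hf, hessian_eq_fderiv_fderiv hf]
  exact (hf.contDiffAt.isSymmSndFDerivAt (by simp)).eq _ _

end SecondOrder

/-! ### Proof of the limit theorem. -/

namespace LinearRepresentation

variable {ℓ m : ℕ} (R : LinearRepresentation ℓ m)

theorem contDiff_y (hM : R.M.IsPrimitive) {n : ℕ∞} : ContDiff ℝ n R.y :=
  (R.analyticOnNhd_y hM).contDiff.of_le le_top

theorem contDiff_log_y (hM : R.M.IsPrimitive) : ContDiff ℝ 2 fun t => Real.log (R.y t) :=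
  (R.contDiff_y hM (n := 2)).log fun t => (R.y_pos hM t).ne'

/-- Division by λ makes β the gradient of log y at 0, so the centering removes exactly the
first-order Taylor term. -/
theorem inner_β (hM : R.M.IsPrimitive) (t : EuclideanSpace ℝ (Fin ℓ)) :
    inner ℝ t R.β = fderiv ℝ (fun t => Real.log (R.y t)) 0 t := by
  have hd : DifferentiableAt ℝ R.y 0 := (R.contDiff_y hM (n := 1)).differentiable (by norm_num) 0
  rw [fderiv.log hd (R.y_pos hM 0).ne', R.y_zero]
  conv_rhs => rw [← sum_smul_single t]
  simp only [β, PiLp.inner_apply, RCLike.inner_apply, conj_trivial, pderiv_eq_fderiv hd,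
    map_sum, map_smul, _root_.smul_apply, smul_eq_mul]
  exact Finset.sum_congr rfl fun i _ => by ring

theorem tendsto_lengths_val (hlen : ∀ᶠ n : ℕ in atTop, n ∈ R.lengths) :
    Tendsto (fun n : R.lengths => (n : ℕ)) atTop atTop := by
  refine tendsto_atTop.2 fun b => ?_
  obtain ⟨n, hn, hbn⟩ := (hlen.and (eventually_ge_atTop b)).exists
  filter_upwards [eventually_ge_atTop (⟨n, hn⟩ : R.lengths)] with k hk
  exact hbn.trans hk

theorem exists_ξ_pos (hlen : ∀ᶠ n : ℕ in atTop, n ∈ R.lengths) : ∃ i, 0 < R.ξ i := by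
  by_contra! h
  have h0 : R.ξ = 0 := funext fun i => le_antisymm (h i) (R.ξ_nonneg i)
  obtain ⟨n, w, hw⟩ := hlen.exists
  simp [coeff, h0] at hw

theorem exists_η_pos (hlen : ∀ᶠ n : ℕ in atTop, n ∈ R.lengths) : ∃ i, 0 < R.η i := by
  by_contra! h
  have h0 : R.η = 0 := funext fun i => le_antisymm (h i) (R.η_nonneg i)
  obtain ⟨n, w, hw⟩ := hlen.exists
  simp [coeff, h0] at hw

theorem tendsto_integral_exp_inner_normalizedY (hlen : ∀ᶠ n : ℕ in atTop, n ∈ R.lengths)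
    (hM : R.M.IsPrimitive) (t : EuclideanSpace ℝ (Fin ℓ)) :
    Tendsto
      (fun n : R.lengths => ∫ w, Real.exp (inner ℝ t (R.normalizedY n w)) ∂(R.wordMeasure n))
      atTop (𝓝 (Real.exp (1 / 2 * (t.ofLp ⬝ᵥ (R.Γ *ᵥ t.ofLp))))) := by
  obtain ⟨C, hC, hlim⟩ := R.exists_tendsto_dotProduct_div_pow hM (R.exists_ξ_pos hlen)
    (R.exists_η_pos hlen)
  have hval := R.tendsto_lengths_val hlen
  have hs : Tendsto (fun n : R.lengths => (Real.sqrt (n : ℕ))⁻¹ • t) atTop (𝓝 0) := by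
    have h : Tendsto (fun n : ℕ => (Real.sqrt n)⁻¹) atTop (𝓝 0) :=
      tendsto_inv_atTop_zero.comp (Real.tendsto_sqrt_atTop.comp tendsto_natCast_atTop_atTop)
    simpa using (h.comp hval).smul_const t
  -- Both s_n = t/√n and s_n = 0 have the same constant C, so the quotient tends to 1.
  have h1 := (hlim hval hs).div (hlim hval (tendsto_const_nhds (x := 0))) hC.ne'
  rw [div_self hC.ne'] at h1
  have h2 := (Real.continuous_exp.tendsto _).comp
    ((tendsto_mul_sub_sqrt_mul_fderiv (R.contDiff_log_y hM) t).comp hval)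
  rw [Γ, dotProduct_hessian_mulVec (R.contDiff_log_y hM)]
  have h3 := h2.mul h1
  rw [mul_one] at h3
  refine h3.congr fun n => ?_
  rw [integral_exp_inner_normalizedY, R.inner_β hM]
  have hy0 : 0 < R.y 0 := R.y_pos hM 0
  have hy1 : 0 < R.y ((Real.sqrt (n : ℕ))⁻¹ • t) := R.y_pos hM _
  simp only [Function.comp, Pi.div_apply]
  rw [sub_eq_add_neg, Real.exp_add, ← Real.log_div hy1.ne' hy0.ne', ← Real.log_pow,
    Real.exp_log (pow_pos (div_pos hy1 hy0) _), div_pow, div_div_div_eq]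
  generalize R.y ((Real.sqrt (n : ℕ))⁻¹ • t) = y₁ at hy1 ⊢
  generalize R.ξ ⬝ᵥ (R.Mt ((Real.sqrt (n : ℕ))⁻¹ • t) ^ (n : ℕ) *ᵥ R.η) = u
  have := (pow_pos hy1 (n : ℕ)).ne'
  have := (pow_pos hy0 (n : ℕ)).ne'
  field_simp

/-- Adding the limits at t and -t and using e^u + e^{-u} ≥ 2 gives exp(t'Γt/2) ≥ 1, without any
convergence of covariances. -/
theorem posSemidef_Γ (hlen : ∀ᶠ n : ℕ in atTop, n ∈ R.lengths) (hM : R.M.IsPrimitive) :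
    R.Γ.PosSemidef := by
  refine .of_dotProduct_mulVec_nonneg (isHermitian_hessian (R.contDiff_log_y hM) 0) fun x => ?_
  rw [star_trivial]
  have : (atTop : Filter R.lengths).NeBot := by
    have : Nonempty R.lengths := hlen.exists.elim fun n hn => ⟨⟨n, hn⟩⟩
    infer_instance
  set t : EuclideanSpace ℝ (Fin ℓ) := WithLp.toLp 2 x with ht
  have h1 := R.tendsto_integral_exp_inner_normalizedY hlen hM t
  have h2 := R.tendsto_integral_exp_inner_normalizedY hlen hM (-t)
  have h3 : 2 ≤ Real.exp (1 / 2 * (x ⬝ᵥ (R.Γ *ᵥ x))) + Real.exp (1 / 2 * (x ⬝ᵥ (R.Γ *ᵥ x))) := by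
    have hlim := h1.add h2
    simp only [ht, WithLp.ofLp_neg, mulVec_neg, neg_dotProduct, dotProduct_neg, neg_neg] at hlim
    refine ge_of_tendsto' hlim fun n => ?_
    rw [← integral_add (R.integrable_wordMeasure _) (R.integrable_wordMeasure _)]
    calc (2 : ℝ) = ∫ _, (2 : ℝ) ∂(R.wordMeasure n) := by simp
      _ ≤ _ := integral_mono (integrable_const _) (R.integrable_wordMeasure _) fun w => by
        simp only [inner_neg_left]
        have := Real.add_one_le_exp (inner ℝ (WithLp.toLp 2 x) (R.normalizedY n w))
        have := Real.add_one_le_exp (-inner ℝ (WithLp.toLp 2 x) (R.normalizedY n w))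
        linarith
  have h4 : 1 ≤ Real.exp (1 / 2 * (x ⬝ᵥ (R.Γ *ᵥ x))) := by linarith
  have := Real.one_le_exp_iff.1 h4
  linarith

theorem tendstoInDistribution_normalizedY (hlen : ∀ᶠ n : ℕ in atTop, n ∈ R.lengths)
    (hM : R.M.IsPrimitive) :
    TendstoInDistribution (fun n : R.lengths => R.normalizedY n) atTop
      (id : EuclideanSpace ℝ (Fin ℓ) → EuclideanSpace ℝ (Fin ℓ))
      (fun n => R.wordMeasure n) (multivariateGaussian 0 R.Γ) := by
  have hΓ := R.posSemidef_Γ hlen hM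
  have hmeas : ∀ n : R.lengths, Measurable (R.normalizedY n) := fun n _ _ => trivial
  refine ⟨fun n => (hmeas n).aemeasurable, aemeasurable_id, ?_⟩
  have hmap : ∀ (n : R.lengths) (t : EuclideanSpace ℝ (Fin ℓ)),
      ∫ x, Real.exp (inner ℝ t x) ∂((R.wordMeasure n).map (R.normalizedY n))
        = ∫ w, Real.exp (inner ℝ t (R.normalizedY n w)) ∂(R.wordMeasure n) := fun n t =>
    integral_map (hmeas n).aemeasurable (by fun_prop)
  refine tendsto_of_tendsto_integral_exp_inner (fun n t => ?_) (fun t => ?_) fun t => ?_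
  · exact (integrable_map_measure (by fun_prop) (hmeas n).aemeasurable).2
      (R.integrable_wordMeasure _)
  · simpa using integrable_exp_inner_multivariateGaussian hΓ t
  · simp only [ProbabilityMeasure.coe_mk, hmap, Measure.map_id,
      integral_exp_inner_multivariateGaussian hΓ]
    exact R.tendsto_integral_exp_inner_normalizedY hlen hM t

end LinearRepresentation

end RationalModel

theorem theorem5p1 {ℓ m : ℕ} (hℓ : 0 < ℓ) (R : RationalModel.LinearRepresentation ℓ m)
    (hlen : ∀ᶠ n : ℕ in atTop, n ∈ R.lengths)
    (hM : R.M.IsPrimitive) :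
    -- `y(t)` is the Perron-Frobenius eigenvalue of `M(t)` and depends analytically on `t`,
    -- so that `β` and `Γ` are well defined, and `Γ` is a covariance matrix
    (∀ t, RationalModel.IsPerronEigenvalue (R.Mt t) (R.y t)) ∧
    AnalyticOnNhd ℝ R.y Set.univ ∧
    R.Γ.PosSemidef ∧
    -- convergence of the moment generating functions
    (∀ t : EuclideanSpace ℝ (Fin ℓ),
      Tendsto (fun n : R.lengths => ∫ w, Real.exp (inner ℝ t (R.normalizedY n w)) ∂(R.wordMeasure n))
        atTop (𝓝 (Real.exp (1 / 2 * (t.ofLp ⬝ᵥ (R.Γ *ᵥ t.ofLp)))))) ∧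
    -- convergence in distribution to `N(0, Γ)`
    TendstoInDistribution (fun n : R.lengths => R.normalizedY n) atTop
      (id : EuclideanSpace ℝ (Fin ℓ) → EuclideanSpace ℝ (Fin ℓ))
      (fun n => R.wordMeasure n) (multivariateGaussian 0 R.Γ) := by
  have := R.neZero
  exact ⟨fun t => RationalModel.isPerronEigenvalue_perronValue (R.isPrimitive_Mt hM t),
    R.analyticOnNhd_y hM, R.posSemidef_Γ hlen hM,
    R.tendsto_integral_exp_inner_normalizedY hlen hM,
    R.tendstoInDistribution_normalizedY hlen hM⟩
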